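/- Let $\lambda=(\lambda_1,\dots,\lambda_k)$ be a composition of $n$ into $k$ positive parts, let $\Lambda_k$ be the set of all such compositions (of all $n$), and put $s_i=\lambda_1+\cdots+\lambda_i$. A permutation $\pi=\pi_1\cdots\pi_n\in\mathcal S_n$ is $\lambda$-unimodal if each of its $k$ consecutive segments of lengths $\lambda_1,\dots,\lambda_k$ is increasing, then decreasing (either part may be trivial). A $\lambda$-descent of $\pi$ is a position $i\in\{1,\dots,n-1\}\setminus\{s_1,\dots,s_{k-1}\}$ with $\pi_i>\pi_{i+1}$; $\operatorname{des}_\lambda(\pi)$ is their number. Let $\mathcal I^\lambda$ be the set of $\lambda$-unimodal involutions (permutations with $\pi^{-1}=\pi$), let $\mathcal D_i^\lambda$ be the set of those $\pi\in\mathcal I^\lambda$ with $\pi_1\le s_i$ whose first segment is decreasing, and let $\mathcal I_j^\lambda$ be the set of those $\pi\in\mathcal I^\lambda$ such that either $\pi_1>s_j$, or $\pi_1\le s_j$ and the first segment is decreasing. With $x^\lambda=x_1^{\lambda_1}\cdots x_k^{\lambda_k}$ define the formal power series $$L^k=\sum_{\lambda\in\Lambda_k}\sum_{\pi\in\mathcal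 I^\lambda}x^\lambda t^{\operatorname{des}_\lambda(\pi)},\quad L^k_j=\sum_{\lambda\in\Lambda_k}\sum_{\pi\in\mathcal I^\lambda_j}x^\lambda t^{\operatorname{des}_\lambda(\pi)},\quad D^k_i=\sum_{\lambda\in\Lambda_k}\sum_{\pi\in\mathcal D^\lambda_i}x^\lambda t^{\operatorname{des}_\lambda(\pi)}$$ in $x_1,\dots,x_k$ and $t$. For such a series $F$ in fewer $x$-variables, $F(\hat x_a)$ and $F(\hat x_a,\hat x_b)$ denote $F$ written in $t$ and in the variables that remain, in their order, when $x_a$ (respectively $x_a$ and $x_b$) is removed from $x_1,\dots,x_k$. Then: 1. $L^0=1$ and $L^1=\dfrac{x_1}{(1-x_1)(1-x_1t)}$. 2. For $k\ge 2$, $$\begin{aligned}L^k=\frac1{1-x_1}\Big[&(x_1+x_1^2t)L^{k-1}(\hat x_1)+x_1^2t\big(L_1^k+(t-1)D_1^k\big)\\&+\sum_{i=2}^k x_1x_i\big[(t+1)L^{k-1}(\hat x_1)+L^{k-1}_{i-1}(\hat x_i)+(t-1)D^{k-1}_{i-1}(\hat x_i)+L^{k-2}(\hat x_1,\hat x_i)\\&\qquad+t\big(L_i^k+(t-1)D_i^k\big)+L_{i-1}^k+(t-1)D_{i-1}^k\big]\Big].\end{aligned}$$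 3. $L_k^k=D_k^k$ for $k\ge1$, and for $1\le j<k$, $$\begin{aligned}L_j^k=\frac1{1-x_1x_{j+1}}\Big[&D_j^k+\sum_{i=j+2}^k x_1x_iL_{i-1}^k\\&+\sum_{i=j+1}^k x_1x_i\big[(t+1)L^{k-1}(\hat x_1)+L^{k-1}_{i-1}(\hat x_i)+(t-1)D^{k-1}_{i-1}(\hat x_i)+L^{k-2}(\hat x_1,\hat x_i)\\&\qquad+t\big(L_i^k+(t-1)D_i^k\big)+(t-1)D_{i-1}^k\big]\Big].\end{aligned}$$ 4. $D_1^k=\dfrac{x_1}{1-x_1t}L^{k-1}(\hat x_1)$ for $k\ge1$, and for $1<i\le k$, $$D_i^k=\frac1{1-x_1x_it^2}\Big[D_{i-1}^k+x_1x_i\big[tD_{i-1}^k+tD_{i-1}^{k-1}(\hat x_i)+L^{k-2}(\hat x_1,\hat x_i)+(t+1)L^{k-1}(\hat x_1)\big]\Big].$$ -/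

import Mathlib

open scoped BigOperators

noncomputable section

namespace LambdaUnimodal

/-! Compositions into `k` positive parts are functions `l : Fin k → ℕ` with positive values; the
composed integer is `n = ∑ i, l i`.  A permutation `π ∈ S_n` is an element of
`Equiv.Perm (Fin n)`, so the entry `π_{p+1}` of the one-line notation on
`{1, …, n}` is `π p + 1` for `p : Fin n`. -/

/-- The partial sum `s_i = l_1 + ⋯ + l_i`, the sum of the first `i` parts. -/
def partSum {k : ℕ} (l : Fin k → ℕ) (i : ℕ) : ℕ :=
  ∑ j ∈ Finset.univ.filter (fun j : Fin k => (j : ℕ) < i), l j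

/-- The set of positions that form the segment of the part `l i` (for `i : Fin k`, that is, the
`(i+1)`-st segment). -/
def seg {k : ℕ} (l : Fin k → ℕ) (n : ℕ) (i : Fin k) : Set (Fin n) :=
  {p | partSum l i ≤ p ∧ (p : ℕ) < partSum l (i + 1)}

/-- `π` is increasing, then decreasing, on the set `S` of positions; `p` is the place of the
maximum. -/
def IsUnimodalOn {n : ℕ} (π : Equiv.Perm (Fin n)) (S : Set (Fin n)) : Prop :=
  ∃ p ∈ S, StrictMonoOn π (S ∩ Set.Iic p) ∧ StrictAntiOn π (S ∩ Set.Ici p)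

/-- `π` is `l`-unimodal: each of the contiguous segments given by `l` is unimodal. -/
def IsUnimodal {k n : ℕ} (l : Fin k → ℕ) (π : Equiv.Perm (Fin n)) : Prop :=
  ∀ i : Fin k, IsUnimodalOn π (seg l n i)

/-- The descent set of `π`, as a set of 1-based positions: `i` with `1 ≤ i < n` belongs to it if
`π_i > π_{i+1}`. -/
def Des {n : ℕ} (π : Equiv.Perm (Fin n)) : Set ℕ :=
  {i | ∃ p q : Fin n, (p : ℕ) + 1 = i ∧ (q : ℕ) = i ∧ π q < π p}

/-- The set of `l`-descents: the descents other than `s_1, s_2, …, s_{k-1}`. -/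
def DesL {k n : ℕ} (l : Fin k → ℕ) (π : Equiv.Perm (Fin n)) : Set ℕ :=
  Des π \ {i | ∃ j, 1 ≤ j ∧ j < k ∧ i = partSum l j}

/-- The number of `l`-descents. -/
def desL {k n : ℕ} (l : Fin k → ℕ) (π : Equiv.Perm (Fin n)) : ℕ := (DesL l π).ncard

/-- The entry `π_1 ∈ {1, …, n}` (and `0` for the empty permutation, which has no first entry). -/
def firstEntry {n : ℕ} (π : Equiv.Perm (Fin n)) : ℕ :=
  if h : 0 < n then (π ⟨0, h⟩ : ℕ) + 1 else 0

/-- The first segment of `π` is decreasing. -/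
def FirstDecreasing {k n : ℕ} (l : Fin k → ℕ) (π : Equiv.Perm (Fin n)) : Prop :=
  ∀ i : Fin k, (i : ℕ) = 0 → StrictAntiOn π (seg l n i)

/-- The set of `l`-unimodal involutions (`π` is its own inverse). -/
def setI {k n : ℕ} (l : Fin k → ℕ) : Set (Equiv.Perm (Fin n)) :=
  {π | π⁻¹ = π ∧ IsUnimodal l π}

/-- The `l`-unimodal involutions for which either `π_1 ≤ s_j` and the first segment is decreasing,
or `π_1 > s_j`. -/
def setIj {k n : ℕ} (l : Fin k → ℕ) (j : ℕ) : Set (Equiv.Perm (Fin n)) :=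
  {π | π ∈ setI l ∧
    ((firstEntry π ≤ partSum l j ∧ FirstDecreasing l π) ∨ partSum l j < firstEntry π)}

/-- The `l`-unimodal involutions for which `π_1 ≤ s_i` and the first segment is decreasing. -/
def setD {k n : ℕ} (l : Fin k → ℕ) (i : ℕ) : Set (Equiv.Perm (Fin n)) :=
  {π | π ∈ setI l ∧ firstEntry π ≤ partSum l i ∧ FirstDecreasing l π}

/-- Formal power series in `x_1, …, x_k` and `t`.  The index `some i` (`i : Fin k`) stands for
`x_{i+1}`, the index `none` for `t`. -/
abbrev Series (k : ℕ) : Type := MvPowerSeries (Option (Fin k)) ℚ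

/-- The variable `x_{i+1}`. -/
def x {k : ℕ} (i : Fin k) : Series k := MvPowerSeries.X (some i)

/-- The variable `t`. -/
def t {k : ℕ} : Series k := MvPowerSeries.X none

/-- For a family of sets `P l ⊆ S_n` (`n = ∑ l_i`), the generating function
`∑_l ∑_d #{π ∈ P l | des_l π = d} x^l t^d`, where `l` runs over the compositions with `k` positive
parts. It is given by its coefficients: a monomial `m` is `x^l t^d` for `l i = m (some i)` and
`d = m none`, and contributes only if all the `l i` are positive. -/
def genFun (k : ℕ) (P : (l : Fin k → ℕ) → Set (Equiv.Perm (Fin (∑ i, l i)))) : Series k :=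
  fun m => if ∀ i : Fin k, 0 < m (some i) then
      (({π ∈ P (fun i => m (some i)) | desL (fun i => m (some i)) π = m none}.ncard : ℕ) : ℚ)
    else 0

/-- `L^k(x,t)`. -/
def L (k : ℕ) : Series k := genFun k fun l => setI l

/-- `L_j^k(x,t)`. -/
def Lj (k j : ℕ) : Series k := genFun k fun l => setIj l j

/-- `D_i^k(x,t)`. -/
def D (k i : ℕ) : Series k := genFun k fun l => setD l i

/-- `F(x,t; x̂_{i+1})`: the series `F` in `k` variables and `t`, written in those of the variables
`x_1, …, x_{k+1}` that remain, in their order, when `x_{i+1}` is left out (and in `t`). -/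
def hat {k : ℕ} (i : Fin (k + 1)) (F : Series k) : Series (k + 1) :=
  MvPowerSeries.rename (Option.map i.succAbove) F

/-- `F(x,t; x̂_1, x̂_{i+2})`: the variables `x_1` and `x_{i+2}` are left out. (Among
`x_2, …, x_{k+2}` the variable `x_{i+2}` has the 0-based index `i`.) -/
def hat₁ {k : ℕ} (i : Fin (k + 1)) (F : Series k) : Series (k + 2) := hat 0 (hat i F)

end LambdaUnimodal

end

open LambdaUnimodal

/-!
# Recurrences for `λ`-unimodal involutions

An involution `π ∈ S_n` is determined by its first entry `π_1 = m` and by the involution `σ` that is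
left after deleting the positions `1` and `m`, so everything rests on understanding how `σ` and `m`
control `λ`-unimodality and the `λ`-descents of `π`.

If `m = 1`, the first segment of `π` starts with its minimum, and `σ` is arbitrary. Otherwise the
entry `1` stands at position `m`. It is the minimum of its segment, so by unimodality `m` is the
first or the last position of some segment `i` (`eq_or_eq_of_mem_block`), and there is a descent
before it exactly when it is the last and not the only position of its segment. Provided that the
first segment keeps a position, the entry `m` in front of it creates a descent if and only if
`π_2 < m`. In terms of `σ` this means that `σ_1` lies in the first `i - 1` or in the first `i`
segments, according to the end at which `m` stands, and then unimodality forces the rest of the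
first segment to decrease. Thus each `σ` contributes `1`, `t` or `t ^ 2` (`wtL_enlarge`,
`wtL_enlarge_firstDec`). If the first segment or the segment `i` is a single position, it disappears
under the deletion; this is the source of the terms with omitted variables. Since the bookkeeping
allows compositions with zero parts, the four cases are handled at once (`wBlock_enlarge`), and they
are separated only in the passage to power series (`gen_wBlock`, `gen_wBlock_zero`).

The recurrences follow because `L` is the sum over `i` of the generating functions of the
involutions with `π_1` in the segment `i`, `L_j` is `D_j` plus the part of this sum with `i > j`,
and `D_i - D_{i-1}` counts the involutions with `π_1` in the segment `i` and decreasing first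
segment. For `D_1` one obtains `(1 - x_1^2 t^2) D_1 = x_1 (1 + x_1 t) L(x̂_1)` and cancels `1 + x_1 t`.

Positions and values are counted from `0` below. Involutions of `S_n` are encoded as functions
`ℕ → ℕ` that fix all `i ≥ n`, and all conditions are expressed through the relation that `r` and
`r + 1` lie in the same segment.
-/

namespace LambdaUnimodal

open Polynomial

/-! ### Unimodal involutions of the natural numbers -/

/-- `f` is an involution of `ℕ` supported on `{0, …, n - 1}`; such functions encode the involutions
in `S_n`, with positions and values counted from `0`. -/
def Inv (n : ℕ) (f : ℕ → ℕ) : Prop := (∀ i, f (f i) = i) ∧ ∀ i, n ≤ i → f i = i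

theorem Inv.lt {n : ℕ} {f : ℕ → ℕ} (h : Inv n f) {i : ℕ} (hi : i < n) : f i < n := by
  by_contra hc
  have h1 := h.2 (f i) (by omega)
  rw [h.1] at h1
  omega

theorem Inv.injective {n : ℕ} {f : ℕ → ℕ} (h : Inv n f) : Function.Injective f :=
  Function.LeftInverse.injective h.1

theorem finite_inv (n : ℕ) : {f | Inv n f}.Finite := by
  refine Set.Finite.of_injOn (f := fun f (i : Fin n) => (f i : ℕ))
    (t := Set.pi Set.univ fun _ => Set.Iio n) ?_ ?_ (Set.Finite.pi fun _ => Set.finite_Iio n)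
  · intro f hf i _
    exact Inv.lt hf i.2
  · intro f hf g hg h
    funext i
    by_cases hi : i < n
    · exact congrFun h ⟨i, hi⟩
    · rw [hf.2 i (by omega), hg.2 i (by omega)]

/-- Unimodality of `f` on each segment, in local form: within a segment a descent is never followed
by an ascent. Here `A r` says that `r` and `r + 1` lie in the same segment. -/
def Unim (A : ℕ → Prop) (f : ℕ → ℕ) : Prop :=
  ∀ r, A r → A (r + 1) → f (r + 1) < f r → f (r + 2) < f (r + 1)

/-- The descents of `f` inside the segments that `A` describes. -/
def desSet (A : ℕ → Prop) (f : ℕ → ℕ) : Set ℕ := {r | A r ∧ f (r + 1) < f r}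

/-- For a unimodal `f`, the condition that the first segment is decreasing: it need only be tested
at the first step. -/
def FirstDec (A : ℕ → Prop) (f : ℕ → ℕ) : Prop := A 0 → f 1 < f 0

/-- The unimodal involutions supported on `{0, …, n - 1}`. -/
def uinv (n : ℕ) (A : ℕ → Prop) : Set (ℕ → ℕ) := {f | Inv n f ∧ Unim A f}

theorem finite_uinv (n : ℕ) (A : ℕ → Prop) : (uinv n A).Finite :=
  (finite_inv n).subset fun _ h => h.1

/-- The descent enumerator `∑ t ^ des f` of the unimodal involutions with the property `P`. -/
noncomputable def wt (n : ℕ) (A : ℕ → Prop) (P : (ℕ → ℕ) → Prop) : ℚ[X] :=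
  ∑ᶠ f ∈ {f | f ∈ uinv n A ∧ P f}, X ^ (desSet A f).ncard

theorem finite_uinv_and (n : ℕ) (A : ℕ → Prop) (P : (ℕ → ℕ) → Prop) :
    {f | f ∈ uinv n A ∧ P f}.Finite := (finite_uinv n A).subset fun _ h => h.1

theorem wt_congr {n : ℕ} {A : ℕ → Prop} {P Q : (ℕ → ℕ) → Prop}
    (h : ∀ f ∈ uinv n A, P f ↔ Q f) : wt n A P = wt n A Q := by
  unfold wt
  congr! 4 with f
  ext f
  exact and_congr_right (h f)

theorem wt_false {n : ℕ} {A : ℕ → Prop} {P : (ℕ → ℕ) → Prop}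
    (h : ∀ f ∈ uinv n A, ¬ P f) : wt n A P = 0 := by
  unfold wt
  rw [show {f | f ∈ uinv n A ∧ P f} = ∅ from
    Set.eq_empty_of_forall_notMem fun f hf => h f hf.1 hf.2, finsum_mem_empty]

theorem wt_add {n : ℕ} {A : ℕ → Prop} {P Q R : (ℕ → ℕ) → Prop}
    (h : ∀ f ∈ uinv n A, P f ↔ Q f ∨ R f) (h' : ∀ f ∈ uinv n A, Q f → ¬ R f) :
    wt n A P = wt n A Q + wt n A R := by
  unfold wt
  rw [← finsum_mem_union _ (finite_uinv_and n A Q) (finite_uinv_and n A R)]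
  · congr! 4 with f
    ext f
    have := h f
    simp only [Set.mem_ofPred_eq, Set.mem_union]
    tauto
  · rw [Set.disjoint_left]
    exact fun f h1 h2 => h' f h1.1 h1.2 h2.2

theorem coeff_wt (n : ℕ) (A : ℕ → Prop) (P : (ℕ → ℕ) → Prop) (d : ℕ) :
    (wt n A P).coeff d = ({f | f ∈ uinv n A ∧ P f ∧ (desSet A f).ncard = d}.ncard : ℕ) := by
  unfold wt
  rw [finsum_mem_eq_finite_toFinset_sum _ (finite_uinv_and n A P), Polynomial.finsetSum_coeff]
  simp only [coeff_X_pow]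
  rw [Finset.sum_boole]
  congr 1
  rw [← Set.ncard_coe_finset]
  congr 1
  ext f
  simp [and_assoc, eq_comm]

/-! ### Inserting a transposition -/

/-- For `m ≠ 0`, the increasing enumeration of the naturals other than `0` and `m`. -/
def skip (m r : ℕ) : ℕ := if r + 1 < m then r + 1 else r + 2

/-- The inverse of `skip m` on its range. -/
def unskip (m i : ℕ) : ℕ := if i < m then i - 1 else i - 2

/-- The involution that exchanges `0` and `m` and acts as `f` on the other naturals. -/
def ins (m : ℕ) (f : ℕ → ℕ) (i : ℕ) : ℕ :=
  if i = 0 then m else if i = m then 0 else skip m (f (unskip m i))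

theorem unskip_skip (m r : ℕ) : unskip m (skip m r) = r := by
  unfold unskip skip; split_ifs <;> omega

theorem skip_unskip {m i : ℕ} (hm0 : m ≠ 0) (h0 : i ≠ 0) (hm : i ≠ m) :
    skip m (unskip m i) = i := by
  unfold unskip skip; split_ifs <;> omega

theorem skip_ne_zero (m r : ℕ) : skip m r ≠ 0 := by unfold skip; split_ifs <;> omega

theorem skip_ne (m r : ℕ) : skip m r ≠ m := by unfold skip; split_ifs <;> omega

theorem skip_strictMono (m : ℕ) : StrictMono (skip m) := by
  intro a b h; simp only [skip]; split_ifs <;> omega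

theorem skip_lt_iff (m r : ℕ) : skip m r < m ↔ r < m - 1 := by
  unfold skip; split_ifs <;> omega

theorem ins_zero (m : ℕ) (f : ℕ → ℕ) : ins m f 0 = m := by simp [ins]

theorem ins_self (m : ℕ) (f : ℕ → ℕ) : ins m f m = 0 := by simp [ins]

theorem ins_skip (m r : ℕ) (f : ℕ → ℕ) : ins m f (skip m r) = skip m (f r) := by
  simp [ins, skip_ne_zero, skip_ne, unskip_skip]

theorem ins_skip_of {m r i : ℕ} (f : ℕ → ℕ) (h : skip m r = i) : ins m f i = skip m (f r) := by
  rw [← h, ins_skip]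

theorem ins_injective (m : ℕ) : Function.Injective (ins m) := by
  intro f g h
  funext r
  apply (skip_strictMono m).injective
  rw [← ins_skip, h, ins_skip]

theorem inv_ins {n m : ℕ} {f : ℕ → ℕ} (hf : Inv n f) (hm0 : m ≠ 0) (hm : m ≤ n + 1) :
    Inv (n + 2) (ins m f) := by
  constructor
  · intro i
    by_cases h0 : i = 0
    · rw [h0, ins_zero, ins_self]
    by_cases h1 : i = m
    · rw [h1, ins_self, ins_zero]
    · rw [← skip_unskip hm0 h0 h1, ins_skip, ins_skip, hf.1]
  · intro i hi
    rw [← skip_unskip (m := m) (i := i) hm0 (by omega) (by omega), ins_skip,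
      hf.2 _ (by unfold unskip; split_ifs <;> omega)]

theorem exists_ins {n m : ℕ} {g : ℕ → ℕ} (hg : Inv (n + 2) g) (h0 : g 0 = m) (hm : m ≠ 0) :
    ∃ f, Inv n f ∧ ins m f = g := by
  have hm0 : g m = 0 := by rw [← h0, hg.1]
  have hn : m < n + 2 := h0 ▸ hg.lt (by omega)
  have h1 : ∀ r, skip m (unskip m (g (skip m r))) = g (skip m r) := fun r => by
    apply skip_unskip hm
    · intro h
      exact skip_ne m r (hg.injective (h.trans hm0.symm))
    · intro h
      exact skip_ne_zero m r (hg.injective (h.trans h0.symm))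
  refine ⟨fun r => unskip m (g (skip m r)), ⟨fun r => ?_, fun r hr => ?_⟩, ?_⟩
  · simp only [h1, hg.1, unskip_skip]
  · simp only
    rw [hg.2 _ (by unfold skip; split_ifs <;> omega), unskip_skip]
  · funext i
    by_cases hi0 : i = 0
    · rw [hi0, ins_zero, h0]
    by_cases him : i = m
    · rw [him, ins_self, hm0]
    · rw [← skip_unskip hm hi0 him, ins_skip, h1]

theorem ins_lt_of_add_one_eq {m r : ℕ} (f : ℕ → ℕ) (hr : r + 1 = m) (hr0 : r ≠ 0) :
    ins m f (r + 1) < ins m f r := by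
  rw [hr, ins_self, ← skip_unskip (m := m) (i := r) (by omega) hr0 (by omega), ins_skip]
  exact Nat.pos_of_ne_zero (skip_ne_zero _ _)

/-- The links `A` of the positions `0, …, n + 1` restrict to the links `A'` of `0, …, n - 1` when
the positions `0` and `m` are deleted, where `m` is the first or the last position of its segment
(`isEnd`). Thus `m - 1` and `m + 1` lie in different segments, although they become neighbours after
the deletion (`cut`). -/
structure Restricts (n m : ℕ) (A A' : ℕ → Prop) : Prop where
  pos : 1 ≤ m
  le : m ≤ n + 1
  left : ∀ r, r + 2 < m → (A (r + 1) ↔ A' r)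
  right : ∀ r, m ≤ r + 1 → (A (r + 2) ↔ A' r)
  cut : ∀ r, r + 2 = m → ¬ A' r
  isEnd : ¬ (A (m - 1) ∧ A m)
  lt : ∀ r, A' r → r + 1 < n

theorem firstDec_of_link_zero_imp {n m : ℕ} {A : ℕ → Prop} (h : A 0 → m = 1)
    {g : ℕ → ℕ} (hg : g ∈ uinv n A)
    (hm : g 0 = m) : FirstDec A g := by
  intro hA
  have h1 := h hA
  have : g 1 = 0 := by rw [← h1, ← hm, hg.1.1]
  omega

namespace Restricts

variable {n m : ℕ} {A A' : ℕ → Prop} (H : Restricts n m A A') {f : ℕ → ℕ}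

include H

theorem link_iff (r : ℕ) (hr : r + 2 ≠ m) : A (skip m r) ↔ A' r := by
  unfold skip
  split_ifs
  · exact H.left r (by omega)
  · exact H.right r (by omega)

theorem ins_one_lt_iff (hm : m ≠ 1) : ins m f 1 < ins m f 0 ↔ f 0 < m - 1 := by
  have := H.pos
  rw [ins_zero, ins_skip_of (r := 0) f (by unfold skip; split_ifs <;> omega), skip_lt_iff]

/-- After the insertion of `0` and `m`, unimodality at the first position is the only new condition:
if the first step is a descent, the rest of the first segment has to decrease. -/
theorem unim_ins_iff : Unim A (ins m f) ↔
    Unim A' f ∧ (A 0 → m ≠ 1 → f 0 < m - 1 → FirstDec A' f) := by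
  have h1 := H.pos
  constructor
  · intro hU
    refine ⟨fun r hr hr' hlt => ?_, fun hA hm h0 hA' => ?_⟩
    · have e1 : r + 2 ≠ m := fun h => H.cut r h hr
      have e2 : r + 1 + 2 ≠ m := fun h => H.cut _ h hr'
      have s1 : skip m (r + 1) = skip m r + 1 := by unfold skip; split_ifs <;> omega
      have s2 : skip m (r + 2) = skip m r + 2 := by unfold skip; split_ifs <;> omega
      have := hU (skip m r) ((H.link_iff r e1).2 hr) (s1 ▸ (H.link_iff _ e2).2 hr')
      rw [← s1, ← s2] at this
      simpa only [ins_skip, (skip_strictMono m).lt_iff_lt, hlt, true_imp_iff] using this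
    · have e1 : 0 + 2 ≠ m := fun h => H.cut _ h hA'
      have s0 : skip m 0 = 1 := by unfold skip; split_ifs <;> omega
      have s1 : skip m 1 = 2 := by unfold skip; split_ifs <;> omega
      have := hU 0 hA (by simpa [s0] using (H.link_iff 0 e1).2 hA') ((H.ins_one_lt_iff hm).2 h0)
      rw [zero_add, zero_add, ← s1, ins_skip, ins_skip_of f s0] at this
      rwa [(skip_strictMono m).lt_iff_lt] at this
  · rintro ⟨hU, hF⟩ r hr hr' hlt
    by_cases hrm : r = m
    · -- the entry `0` at position `m` is not a descent
      rw [hrm, ins_self] at hlt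
      omega
    by_cases hrm1 : r + 1 = m
    · exact absurd ⟨by rwa [← hrm1, Nat.add_sub_cancel], hrm1 ▸ hr'⟩ H.isEnd
    by_cases hrm2 : r + 2 = m
    · rw [hrm2, ins_self]
      rw [← skip_unskip (m := m) (i := r + 1) (by omega) (by omega) hrm1, ins_skip]
      exact Nat.pos_of_ne_zero (skip_ne_zero _ _)
    rcases Nat.eq_zero_or_pos r with rfl | hpos
    · have s0 : skip m 0 = 1 := by unfold skip; split_ifs <;> omega
      have s1 : skip m 1 = 2 := by unfold skip; split_ifs <;> omega
      have := hF hr (by omega) ((H.ins_one_lt_iff (by omega)).1 hlt)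
        ((H.link_iff 0 (by omega)).1 (by simpa [s0] using hr'))
      rwa [zero_add, zero_add, ← s1, ins_skip, ins_skip_of f s0, (skip_strictMono m).lt_iff_lt]
    · obtain ⟨q, hq⟩ : ∃ q, skip m q = r := ⟨_, skip_unskip (by omega) hpos.ne' hrm⟩
      have hqm : q + 2 ≠ m := fun h => hrm1 (by rw [← hq]; unfold skip; split_ifs <;> omega)
      have hqm' : q + 1 + 2 ≠ m := fun h => hrm2 (by rw [← hq]; unfold skip; split_ifs <;> omega)
      have s1 : skip m (q + 1) = r + 1 := by rw [← hq]; unfold skip; split_ifs <;> omega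
      have s2 : skip m (q + 2) = r + 2 := by rw [← hq]; unfold skip; split_ifs <;> omega
      rw [← s1, ← s2, ins_skip, ins_skip, (skip_strictMono m).lt_iff_lt]
      rw [← s1, ← hq, ins_skip, ins_skip, (skip_strictMono m).lt_iff_lt] at hlt
      exact hU q ((H.link_iff q hqm).1 (hq ▸ hr)) ((H.link_iff _ hqm').1 (s1 ▸ hr')) hlt

/-- The descents of `ins m f` away from the position `0` are those of `f`, and the step down to the
entry `0` at position `m`. -/
theorem mem_desSet_ins_iff {r : ℕ} (hr : r ≠ 0) :
    r ∈ desSet A (ins m f) ↔ r ∈ skip m '' desSet A' f ∨ r + 1 = m ∧ A r := by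
  have h1 := H.pos
  by_cases hrm : r = m
  · subst hrm
    simp [desSet, ins_self, Set.mem_image, skip_ne]
  obtain ⟨q, hq⟩ : ∃ q, skip m q = r := ⟨_, skip_unskip (by omega) hr hrm⟩
  rw [← hq, (skip_strictMono m).injective.mem_set_image, hq]
  by_cases hrm1 : r + 1 = m
  · have hqm : q + 2 = m := by rw [← hq] at hrm1; unfold skip at hrm1; split_ifs at hrm1 <;> omega
    have := ins_lt_of_add_one_eq f hrm1 hr
    rw [hrm1] at this
    simp only [desSet, Set.mem_ofPred_eq, H.cut q hqm, hrm1, false_and, true_and, false_or]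
    exact and_iff_left this
  · have hqm : q + 2 ≠ m := fun h => hrm1 (by rw [← hq]; unfold skip; split_ifs <;> omega)
    have s1 : skip m (q + 1) = r + 1 := by rw [← hq]; unfold skip; split_ifs <;> omega
    simp only [desSet, Set.mem_ofPred_eq, hrm1, false_and, or_false, ← H.link_iff q hqm]
    rw [← s1, ← hq, ins_skip, ins_skip, (skip_strictMono m).lt_iff_lt]

theorem finite_desSet : (desSet A' f).Finite :=
  (Set.finite_lt_nat n).subset fun r hr => by
    have := H.lt r hr.1
    simp only [Set.mem_ofPred_eq]
    omega

open Classical in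
/-- The insertion creates a descent before the position `m`, unless `m` begins a segment, and one
after the position `0` if the old first entry is placed below `m`. If `m = 1`, these are the same
descent. -/
theorem ncard_desSet_ins : (desSet A (ins m f)).ncard =
    (desSet A' f).ncard + (if A (m - 1) then 1 else 0) +
      (if A 0 ∧ m ≠ 1 ∧ f 0 < m - 1 then 1 else 0) := by
  have h1 := H.pos
  have hfin := (H.finite_desSet (f := f)).image (skip m)
  have hcard : (skip m '' desSet A' f).ncard = (desSet A' f).ncard :=
    Set.ncard_image_of_injective _ (skip_strictMono m).injective
  have hstep : ({r | r + 1 = m ∧ A r} ∪ skip m '' desSet A' f).ncard =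
      (desSet A' f).ncard + (if A (m - 1) then 1 else 0) := by
    split_ifs with h
    · rw [show {r | r + 1 = m ∧ A r} = {m - 1} by
        ext r; simp only [Set.mem_ofPred_eq, Set.mem_singleton_iff]
        exact ⟨fun h => by omega, fun h' => ⟨by omega, h' ▸ h⟩⟩, Set.singleton_union,
        Set.ncard_insert_of_notMem _ hfin, hcard]
      rintro ⟨q, hq, hqm⟩
      exact H.cut q (by unfold skip at hqm; split_ifs at hqm <;> omega) hq.1
    · rw [show {r | r + 1 = m ∧ A r} = ∅ from Set.eq_empty_of_forall_notMem fun r hr => h <| by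
        rw [← hr.1, Nat.add_sub_cancel]; exact hr.2, Set.empty_union, hcard, add_zero]
  have hfin' : ({r | r + 1 = m ∧ A r} ∪ skip m '' desSet A' f).Finite :=
    ((Set.finite_singleton (m - 1)).subset fun r hr => by
      have := hr.1; simp only [Set.mem_singleton_iff]; omega).union hfin
  rw [← hstep]
  split_ifs with h
  · rw [← Set.ncard_insert_of_notMem (a := 0) _ hfin']
    · congr 1
      ext r
      by_cases hr : r = 0
      · subst hr
        simpa [desSet, h.1] using (H.ins_one_lt_iff h.2.1).2 h.2.2
      · rw [H.mem_desSet_ins_iff hr, Set.mem_insert_iff, Set.mem_union, or_comm]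
        simp [hr]
    · rintro (h' | ⟨q, _, hq⟩)
      · exact h.2.1 (by rw [← h'.1])
      · exact skip_ne_zero _ _ hq
  · rw [add_zero]
    congr 1
    ext r
    by_cases hr : r = 0
    · subst hr
      have : ¬ ∃ q, q ∈ desSet A' f ∧ skip m q = 0 := fun ⟨q, _, h⟩ => skip_ne_zero _ _ h
      rw [Set.mem_union, Set.mem_image, or_iff_left this]
      by_cases hm1 : m = 1
      · subst hm1
        simp [desSet, ins_self, ins_zero]
      · have := (H.ins_one_lt_iff (f := f) hm1).1
        simp only [desSet, Set.mem_ofPred_eq]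
        constructor
        · exact fun h' => absurd ⟨h'.1, hm1, this h'.2⟩ h
        · exact fun h' => absurd h'.1.symm hm1
    · rw [H.mem_desSet_ins_iff hr, Set.mem_union, or_comm]
      rfl

/-- The unimodal involutions that exchange `0` and `m` arise by insertion. -/
theorem wt_eq (P Q : (ℕ → ℕ) → Prop) (c : ℕ)
    (hPQ : ∀ f, Inv n f → (Unim A (ins m f) ∧ P (ins m f) ↔ Unim A' f ∧ Q f))
    (hc : ∀ f ∈ uinv n A', Q f →
      (desSet A (ins m f)).ncard = (desSet A' f).ncard + c) :
    wt (n + 2) A (fun g => g 0 = m ∧ P g) = X ^ c * wt n A' Q := by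
  unfold wt
  rw [show {g | g ∈ uinv (n + 2) A ∧ g 0 = m ∧ P g} = ins m '' {f | f ∈ uinv n A' ∧ Q f} by
    ext g
    constructor
    · rintro ⟨⟨hg, hU⟩, h0, hP⟩
      obtain ⟨f, hf, rfl⟩ := exists_ins hg h0 (by have := H.pos; omega)
      have := (hPQ f hf).1 ⟨hU, hP⟩
      exact ⟨f, ⟨⟨hf, this.1⟩, this.2⟩, rfl⟩
    · rintro ⟨f, ⟨⟨hf, hU⟩, hQ⟩, rfl⟩
      have := (hPQ f hf).2 ⟨hU, hQ⟩
      exact ⟨⟨inv_ins hf (by have := H.pos; omega) H.le, this.1⟩, ins_zero m f, this.2⟩,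
    finsum_mem_image (ins_injective m).injOn, mul_finsum_mem]
  refine finsum_mem_congr rfl fun f hf => ?_
  rw [hc f hf.1 hf.2, pow_add, mul_comm]

open Classical in
theorem wt_of_link_zero_imp (h : A 0 → m = 1) :
    wt (n + 2) A (fun g => g 0 = m) =
      X ^ (if A (m - 1) then 1 else 0) * wt n A' (fun _ => True) := by
  have := H.wt_eq (fun _ => True) (fun _ => True) (if A (m - 1) then 1 else 0)
    (fun f _ => by rw [H.unim_ins_iff]; tauto)
    (fun f _ _ => by
      rw [H.ncard_desSet_ins,
        if_neg (c := A 0 ∧ m ≠ 1 ∧ f 0 < m - 1) (fun h' => h'.2.1 (h h'.1)), add_zero])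
  simpa using this

variable (hA : A 0) (hm : m ≠ 1)

include hA hm

theorem firstDec_ins_iff : FirstDec A (ins m f) ↔ f 0 < m - 1 := by
  rw [← H.ins_one_lt_iff hm]
  exact forall_prop_of_true hA

open Classical in
theorem wt_firstDec_of_link_zero :
    wt (n + 2) A (fun g => g 0 = m ∧ FirstDec A g) =
      X ^ ((if A (m - 1) then 1 else 0) + 1) *
        wt n A' (fun f => f 0 < m - 1 ∧ FirstDec A' f) := by
  refine H.wt_eq _ _ _ (fun f _ => ?_) (fun f _ hQ => ?_)
  · rw [H.unim_ins_iff, H.firstDec_ins_iff hA hm]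
    tauto
  · rw [H.ncard_desSet_ins, if_pos (c := A 0 ∧ m ≠ 1 ∧ f 0 < m - 1) ⟨hA, hm, hQ.1⟩, add_assoc]

open Classical in
theorem wt_not_firstDec_of_link_zero :
    wt (n + 2) A (fun g => g 0 = m ∧ ¬ FirstDec A g) =
      X ^ (if A (m - 1) then 1 else 0) * wt n A' (fun f => m - 1 ≤ f 0) := by
  refine H.wt_eq _ _ _ (fun f _ => ?_) (fun f _ hQ => ?_)
  · rw [H.unim_ins_iff, H.firstDec_ins_iff hA hm, ← not_lt]
    tauto
  · rw [H.ncard_desSet_ins, if_neg (c := A 0 ∧ m ≠ 1 ∧ f 0 < m - 1) (fun h => by omega), add_zero]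

open Classical in
theorem wt_of_link_zero :
    wt (n + 2) A (fun g => g 0 = m) =
      X ^ (if A (m - 1) then 1 else 0) * (wt n A' (fun f => m - 1 ≤ f 0) +
        X * wt n A' (fun f => f 0 < m - 1 ∧ FirstDec A' f)) := by
  rw [wt_add (Q := fun g => g 0 = m ∧ ¬ FirstDec A g) (R := fun g => g 0 = m ∧ FirstDec A g)
    (fun f _ => by tauto) (fun f _ => by tauto), H.wt_not_firstDec_of_link_zero hA hm,
    H.wt_firstDec_of_link_zero hA hm]
  ring

end Restricts

/-! ### Inserting a fixed point -/

/-- The involution that fixes `0` and acts as `f` on the positive naturals. -/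
def shift (f : ℕ → ℕ) (i : ℕ) : ℕ := if i = 0 then 0 else f (i - 1) + 1

theorem shift_zero (f : ℕ → ℕ) : shift f 0 = 0 := rfl

theorem shift_succ (f : ℕ → ℕ) (i : ℕ) : shift f (i + 1) = f i + 1 := rfl

theorem shift_injective : Function.Injective shift := fun f g h => by
  funext i
  have := congrFun h (i + 1)
  simpa [shift_succ] using this

theorem inv_shift_iff {n : ℕ} {f : ℕ → ℕ} : Inv (n + 1) (shift f) ↔ Inv n f := by
  constructor
  · rintro ⟨h1, h2⟩
    refine ⟨fun i => ?_, fun i hi => ?_⟩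
    · simpa [shift_succ] using h1 (i + 1)
    · simpa [shift_succ] using h2 (i + 1) (by omega)
  · rintro ⟨h1, h2⟩
    refine ⟨fun i => ?_, fun i hi => ?_⟩
    · cases i
      · rfl
      · rw [shift_succ, shift_succ, h1]
    · cases i
      · rfl
      · rw [shift_succ, h2 _ (by omega)]

theorem exists_shift {n : ℕ} {g : ℕ → ℕ} (hg : Inv n g) (h0 : g 0 = 0) : ∃ f, shift f = g := by
  refine ⟨fun i => g (i + 1) - 1, ?_⟩
  funext i
  cases i with
  | zero => rw [shift_zero, h0]
  | succ i =>
    have : g (i + 1) ≠ 0 := fun h => by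
      have := hg.injective (h.trans h0.symm)
      omega
    rw [shift_succ]
    omega

theorem wt_fixed {n : ℕ} {A A' : ℕ → Prop} (hA : ∀ r, A (r + 1) ↔ A' r) :
    wt (n + 1) A (fun g => g 0 = 0) = wt n A' (fun _ => True) := by
  have hU : ∀ f, Unim A (shift f) ↔ Unim A' f := fun f => by
    constructor
    · intro h r hr hr'
      simpa [shift_succ] using h (r + 1) ((hA _).2 hr) ((hA _).2 hr')
    · intro h r hr hr'
      cases r with
      | zero => simp [shift_zero]
      | succ r => simpa [shift_succ] using h r ((hA _).1 hr) ((hA _).1 hr')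
  unfold wt
  rw [show {g | g ∈ uinv (n + 1) A ∧ g 0 = 0} = shift '' {f | f ∈ uinv n A' ∧ True} by
    ext g
    constructor
    · rintro ⟨⟨hg, hU'⟩, h0⟩
      obtain ⟨f, rfl⟩ := exists_shift hg h0
      exact ⟨f, ⟨⟨inv_shift_iff.1 hg, (hU f).1 hU'⟩, trivial⟩, rfl⟩
    · rintro ⟨f, ⟨⟨hf, hU'⟩, -⟩, rfl⟩
      exact ⟨⟨inv_shift_iff.2 hf, (hU f).2 hU'⟩, shift_zero f⟩,
    finsum_mem_image shift_injective.injOn]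
  refine finsum_mem_congr rfl fun f _ => ?_
  rw [show desSet A (shift f) = Nat.succ '' desSet A' f by
    ext r
    cases r with
    | zero => simp [desSet, shift_zero]
    | succ r => simp [desSet, shift_succ, hA], Set.ncard_image_of_injective _ Nat.succ_injective]

/-! ### Segments of a composition -/

section PartSum

variable {k : ℕ} (l : Fin k → ℕ)

theorem partSum_eq (j : ℕ) : partSum l j = ∑ a : Fin k, if (a : ℕ) < j then l a else 0 := by
  rw [partSum, Finset.sum_filter]

theorem partSum_zero : partSum l 0 = 0 := by simp [partSum_eq]

theorem partSum_mono : Monotone (partSum l) := by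
  intro a b h
  rw [partSum_eq, partSum_eq]
  refine Finset.sum_le_sum fun c _ => ?_
  split_ifs <;> omega

theorem partSum_of_le {j : ℕ} (h : k ≤ j) : partSum l j = ∑ a, l a := by
  rw [partSum_eq]
  exact Finset.sum_congr rfl fun a _ => if_pos (by omega)

theorem partSum_le (j : ℕ) : partSum l j ≤ ∑ a, l a := by
  rw [partSum_eq]
  refine Finset.sum_le_sum fun c _ => ?_
  split_ifs <;> omega

theorem partSum_succ (i : Fin k) : partSum l (i + 1) = partSum l i + l i := by
  rw [partSum_eq, partSum_eq, ← Finset.add_sum_erase _ _ (Finset.mem_univ i),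
    ← Finset.add_sum_erase _ (fun a : Fin k => if (a : ℕ) < i then l a else 0) (Finset.mem_univ i)]
  rw [if_pos (Nat.lt_succ_self _), if_neg (lt_irrefl _), zero_add, add_comm]
  congr 1
  refine Finset.sum_congr rfl fun a ha => ?_
  have : (a : ℕ) ≠ i := fun h => (Finset.mem_erase.1 ha).1 (Fin.ext h)
  exact if_congr (by omega) rfl rfl

theorem partSum_add_single (a : Fin k) (c j : ℕ) :
    partSum (l + Pi.single a c) j = partSum l j + if (a : ℕ) < j then c else 0 := by
  rw [partSum_eq, partSum_eq,
    show (if (a : ℕ) < j then c else 0) =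
      ∑ b : Fin k, if b = a then (if (a : ℕ) < j then c else 0) else 0 by simp,
    ← Finset.sum_add_distrib]
  refine Finset.sum_congr rfl fun b _ => ?_
  by_cases h : b = a
  · subst h
    simp only [Pi.add_apply, Pi.single_eq_same, if_true]
    split_ifs <;> rfl
  · simp [h]

theorem partSum_succAbove {l : Fin (k + 1) → ℕ} {i : Fin (k + 1)} (h : l i = 0) (j : ℕ) :
    partSum l j = partSum (l ∘ i.succAbove) (if j ≤ i then j else j - 1) := by
  rw [partSum_eq, partSum_eq, Fin.sum_univ_succAbove _ i, h, ite_self, zero_add]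
  refine Finset.sum_congr rfl fun a _ => if_congr ?_ rfl rfl
  rcases lt_or_ge a.castSucc i with hlt | hge
  · have h1 : (a : ℕ) < i := hlt
    rw [Fin.succAbove_of_castSucc_lt _ _ hlt, Fin.val_castSucc]
    split_ifs <;> omega
  · have h1 : (i : ℕ) ≤ a := hge
    rw [Fin.succAbove_of_le_castSucc _ _ hge, Fin.val_succ]
    split_ifs <;> omega

theorem sum_succAbove {l : Fin (k + 1) → ℕ} {i : Fin (k + 1)} (h : l i = 0) :
    ∑ a, l a = ∑ a, (l ∘ i.succAbove) a := by
  rw [Fin.sum_univ_succAbove _ i, h, zero_add]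
  rfl

end PartSum

/-- The positions `r` and `r + 1` lie in the same segment of the composition `l`. Zero parts are
allowed in `l`; they have no influence. -/
def link {k : ℕ} (l : Fin k → ℕ) (r : ℕ) : Prop := r + 1 < ∑ i, l i ∧ ∀ j, partSum l j ≠ r + 1

theorem link_succAbove {k : ℕ} {l : Fin (k + 1) → ℕ} {i : Fin (k + 1)} (h : l i = 0) :
    link (l ∘ i.succAbove) = link l := by
  funext r
  refine propext (and_congr (by rw [sum_succAbove h]) ⟨fun H j => ?_, fun H j => ?_⟩)
  · rw [partSum_succAbove h]
    exact H _
  · by_cases hj : j ≤ i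
    · simpa [partSum_succAbove h, hj] using H j
    · have := H (j + 1)
      rwa [partSum_succAbove h, if_neg (by omega), Nat.add_sub_cancel] at this

/-- The descent enumerator of the `l`-unimodal involutions with the property `P`. -/
noncomputable def wtL {k : ℕ} (l : Fin k → ℕ) (P : (ℕ → ℕ) → Prop) : ℚ[X] :=
  wt (∑ i, l i) (link l) P

theorem wtL_succAbove {k : ℕ} {l : Fin (k + 1) → ℕ} {i : Fin (k + 1)} (h : l i = 0)
    (P : (ℕ → ℕ) → Prop) : wtL (l ∘ i.succAbove) P = wtL l P := by
  rw [wtL, wtL, link_succAbove h, ← sum_succAbove h]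

/-- The descent enumerator of all `l`-unimodal involutions. -/
noncomputable def wAll {k : ℕ} (l : Fin k → ℕ) : ℚ[X] := wtL l fun _ => True

/-- The descent enumerator of the `l`-unimodal involutions whose first entry lies beyond the first
`j` segments. -/
noncomputable def wGe {k : ℕ} (j : ℕ) (l : Fin k → ℕ) : ℚ[X] := wtL l fun f => partSum l j ≤ f 0

/-- The descent enumerator of the `l`-unimodal involutions whose first entry lies in the first `j`
segments and whose first segment is decreasing. -/
noncomputable def wDec {k : ℕ} (j : ℕ) (l : Fin k → ℕ) : ℚ[X] :=
  wtL l fun f => f 0 < partSum l j ∧ FirstDec (link l) f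

/-- The descent enumerator of the `l`-unimodal involutions whose first entry lies in the segment
number `i`, counted from `0`. -/
noncomputable def wBlock {k : ℕ} (i : ℕ) (l : Fin k → ℕ) : ℚ[X] :=
  wtL l fun f => partSum l i ≤ f 0 ∧ f 0 < partSum l (i + 1)

/-- As `wBlock`, with the first segment decreasing. -/
noncomputable def wBlockDec {k : ℕ} (i : ℕ) (l : Fin k → ℕ) : ℚ[X] :=
  wtL l fun f => (partSum l i ≤ f 0 ∧ f 0 < partSum l (i + 1)) ∧ FirstDec (link l) f

theorem wAll_succAbove {k : ℕ} {l : Fin (k + 1) → ℕ} {i : Fin (k + 1)} (h : l i = 0) :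
    wAll (l ∘ i.succAbove) = wAll l := wtL_succAbove h _

theorem wGe_succAbove {k : ℕ} {l : Fin (k + 1) → ℕ} {i : Fin (k + 1)} (h : l i = 0) {j : ℕ}
    (hj : j ≤ i) : wGe j (l ∘ i.succAbove) = wGe j l := by
  rw [wGe, wtL_succAbove h, wGe, partSum_succAbove h, if_pos hj]

theorem wDec_succAbove {k : ℕ} {l : Fin (k + 1) → ℕ} {i : Fin (k + 1)} (h : l i = 0) {j : ℕ}
    (hj : j ≤ i) : wDec j (l ∘ i.succAbove) = wDec j l := by
  rw [wDec, wtL_succAbove h, wDec, partSum_succAbove h, if_pos hj, link_succAbove h]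

theorem wGe_eq_add {k : ℕ} (i : ℕ) (l : Fin k → ℕ) : wGe i l = wBlock i l + wGe (i + 1) l := by
  have := partSum_mono l (Nat.le_add_right i 1)
  exact wt_add (fun f _ => by omega) (fun f _ => by omega)

theorem wDec_succ {k : ℕ} (i : ℕ) (l : Fin k → ℕ) :
    wDec (i + 1) l = wDec i l + wBlockDec i l := by
  have := partSum_mono l (Nat.le_add_right i 1)
  refine wt_add (fun f _ => ?_) (fun f _ h h' => by omega)
  rw [← or_and_right]
  exact and_congr_left fun _ => by omega

theorem wGe_zero {k : ℕ} (l : Fin k → ℕ) : wGe 0 l = wAll l :=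
  wt_congr fun f _ => by simp [partSum_zero]

theorem wDec_zero {k : ℕ} (l : Fin k → ℕ) : wDec 0 l = 0 :=
  wt_false fun f _ => by simp [partSum_zero]

theorem wGe_self {k : ℕ} (l : Fin k → ℕ) (h : 0 < ∑ i, l i) : wGe k l = 0 :=
  wt_false fun f hf => by
    rw [partSum_of_le l le_rfl, not_le]
    exact hf.1.lt h

/-- The entry `0` is the minimum of its segment, so by unimodality it is at one of its two ends. -/
theorem eq_or_eq_of_mem_block {k : ℕ} {l : Fin k → ℕ} {i : ℕ} {f : ℕ → ℕ}
    (hf : f ∈ uinv (∑ i, l i) (link l)) (h0 : f 0 ≠ 0) (hi : partSum l i ≤ f 0)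
    (hi' : f 0 < partSum l (i + 1)) : f 0 = partSum l i ∨ f 0 + 1 = partSum l (i + 1) := by
  obtain ⟨m, hm⟩ : ∃ m, f 0 = m + 1 := Nat.exists_eq_succ_of_ne_zero h0
  rw [hm] at hi hi' ⊢
  have hn := hi'.trans_le (partSum_le l _)
  have hm0 : f (m + 1) = 0 := by rw [← hm, hf.1.1]
  by_contra hc
  push Not at hc
  have hpos : f (m + 1) < f m := by
    rw [hm0]
    refine Nat.pos_of_ne_zero fun h => ?_
    have := hf.1.injective (hm0.trans h.symm)
    omega
  have := hf.2 m ⟨hn, fun j hj => ?_⟩ ⟨?_, fun j hj => ?_⟩ hpos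
  · omega
  · rcases le_or_gt j i with h | h
    · have := partSum_mono l h
      omega
    · have := partSum_mono l (show i + 1 ≤ j from h)
      omega
  · have := partSum_le l (i + 1)
    omega
  · rcases le_or_gt j i with h | h
    · have := partSum_mono l h
      omega
    · have := partSum_mono l (show i + 1 ≤ j from h)
      omega

section Insert

variable {k : ℕ} (l : Fin (k + 1) → ℕ) (i : Fin (k + 1))

/-- The composition in which the part `0` and the part `i` are enlarged by one each (by two if
`i = 0`). -/
def enlarge : Fin (k + 1) → ℕ := l + Pi.single i 1 + Pi.single 0 1

theorem partSum_enlarge (j : ℕ) : partSum (enlarge l i) j =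
    partSum l j + (if (i : ℕ) < j then 1 else 0) + (if 0 < j then 1 else 0) := by
  rw [enlarge, partSum_add_single, partSum_add_single]
  rfl

theorem sum_enlarge : ∑ a, enlarge l i a = (∑ a, l a) + 2 := by
  rw [← partSum_of_le _ le_rfl, partSum_enlarge, partSum_of_le _ le_rfl, if_pos i.2,
    if_pos (Nat.succ_pos k)]

/-- The two ends of the segment `i` of `enlarge l i` are the positions `partSum l q + 1` for `q = i`
and `q = i + 1`. The condition `0 < q` excludes the position `0` itself. -/
theorem restricts_enlarge {q : ℕ} (hq : 0 < q) (hi : (i : ℕ) ≤ q) (hi' : q ≤ i + 1) :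
    Restricts (∑ a, l a) (partSum l q + 1) (link (enlarge l i)) (link l) := by
  have hle := partSum_le l q
  have hmono : ∀ j, (j ≤ q → partSum l j ≤ partSum l q) ∧ (q ≤ j → partSum l q ≤ partSum l j) :=
    fun j => ⟨fun h => partSum_mono l h, fun h => partSum_mono l h⟩
  have h0 := partSum_zero l
  constructor
  · omega
  · omega
  · intro r hr
    rw [link, link, sum_enlarge]
    refine and_congr (by omega) (forall_congr' fun j => not_congr ?_)
    rw [partSum_enlarge]
    have := hmono j
    rcases Nat.eq_zero_or_pos j with rfl | hj
    · simp [h0]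
    · split_ifs <;> omega
  · intro r hr
    rw [link, link, sum_enlarge]
    refine and_congr (by omega) (forall_congr' fun j => not_congr ?_)
    rw [partSum_enlarge]
    have := hmono j
    rcases Nat.eq_zero_or_pos j with rfl | hj
    · simp [h0]
    · split_ifs <;> omega
  · intro r hr h
    exact h.2 q (by omega)
  · rintro ⟨h1, h2⟩
    have h1 := h1.2 q
    have h2 := h2.2 q
    rw [partSum_enlarge] at h1 h2
    split_ifs at h1 h2 <;> omega
  · exact fun r hr => hr.1

theorem partSum_one : partSum l 1 = l 0 := by
  have := partSum_succ l 0
  simpa [partSum_zero] using this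

theorem link_enlarge_zero : link (enlarge l i) 0 ↔ i = 0 ∨ l 0 ≠ 0 := by
  have h1 := partSum_enlarge l i 1
  rw [partSum_one l] at h1
  constructor
  · intro h
    by_contra hc
    push Not at hc
    have h2 := h.2 1
    have : (i : ℕ) ≠ 0 := fun h => hc.1 (Fin.ext h)
    rw [h1] at h2
    split_ifs at h2 <;> omega
  · intro h
    refine ⟨by rw [sum_enlarge]; omega, fun j hj => ?_⟩
    rcases Nat.eq_zero_or_pos j with rfl | hpos
    · simp [partSum_zero] at hj
    · have h2 := partSum_mono (enlarge l i) (show 1 ≤ j from hpos)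
      rw [h1] at h2
      rcases h with rfl | h
      · simp at h2; omega
      · split_ifs at h2 <;> omega

theorem link_enlarge_start (hi : i ≠ 0) : ¬ link (enlarge l i) (partSum l i) := fun h => by
  have hi0 : (i : ℕ) ≠ 0 := fun h => hi (Fin.ext h)
  have := h.2 i
  rw [partSum_enlarge] at this
  split_ifs at this <;> omega

theorem link_enlarge_end (hi : i = 0 ∨ l i ≠ 0) : link (enlarge l i) (partSum l (i + 1)) := by
  have hle := partSum_le l (i + 1)
  refine ⟨by rw [sum_enlarge]; omega, fun j => ?_⟩
  rw [partSum_enlarge]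
  have h1 := partSum_succ l i
  rcases Nat.eq_zero_or_pos j with rfl | hpos
  · simp [partSum_zero]
  rcases le_or_gt j i with h | h
  · have := partSum_mono l h
    have hi' : l i ≠ 0 := hi.resolve_left fun h0 => by
      rw [h0] at h; simp at h; omega
    split_ifs <;> omega
  · have := partSum_mono l (show (i : ℕ) + 1 ≤ j from h)
    split_ifs <;> omega

variable {l i}

theorem link_enlarge_zero_imp (h : l 0 = 0) {q : ℕ} (hq : 0 < q) (hi : q ≤ i + 1) :
    link (enlarge l i) 0 → partSum l q + 1 = 1 := by
  rw [link_enlarge_zero]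
  rintro (rfl | h0)
  · obtain rfl : q = 1 := by rw [Fin.val_zero] at hi; omega
    rw [partSum_one, h]
  · exact absurd h h0

theorem partSum_add_one_ne_one (h : l 0 ≠ 0) {q : ℕ} (hq : 0 < q) : partSum l q + 1 ≠ 1 := by
  have := partSum_mono l (show 1 ≤ q from hq)
  rw [partSum_one] at this
  omega

open Classical in
/-- Deleting the positions `0` and `m = f 0` from an involution with `f 0 = m`, where `m` is the
first (`q = i`) or the last (`q = i + 1`) position of the segment `i`. If the first segment becomes
empty, no condition is left; otherwise the new first step is a descent if and only if the remaining
involution begins with an entry below `m`, and then the first segment has to be decreasing. -/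
theorem wtL_enlarge {q : ℕ} (hq : 0 < q) (hi : (i : ℕ) ≤ q) (hi' : q ≤ i + 1) :
    wtL (enlarge l i) (fun g => g 0 = partSum l q + 1) =
      X ^ (if link (enlarge l i) (partSum l q) then 1 else 0) *
        (if l 0 = 0 then wAll l else wGe q l + X * wDec q l) := by
  have H := restricts_enlarge l i hq hi hi'
  rw [wtL, sum_enlarge]
  split_ifs with h1 h2 h2
  · rw [H.wt_of_link_zero_imp (link_enlarge_zero_imp h2 hq hi'), Nat.add_sub_cancel, if_pos h1]
    rfl
  · rw [H.wt_of_link_zero ((link_enlarge_zero l i).2 (.inr h2)) (partSum_add_one_ne_one h2 hq),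
      Nat.add_sub_cancel, if_pos h1]
    rfl
  · rw [H.wt_of_link_zero_imp (link_enlarge_zero_imp h2 hq hi'), Nat.add_sub_cancel, if_neg h1]
    rfl
  · rw [H.wt_of_link_zero ((link_enlarge_zero l i).2 (.inr h2)) (partSum_add_one_ne_one h2 hq),
      Nat.add_sub_cancel, if_neg h1]
    rfl

open Classical in
/-- The variant of `wtL_enlarge` for involutions whose first segment is decreasing. -/
theorem wtL_enlarge_firstDec {q : ℕ} (hq : 0 < q) (hi : (i : ℕ) ≤ q) (hi' : q ≤ i + 1) :
    wtL (enlarge l i) (fun g => g 0 = partSum l q + 1 ∧ FirstDec (link (enlarge l i)) g) =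
      X ^ (if link (enlarge l i) (partSum l q) then 1 else 0) *
        (if l 0 = 0 then wAll l else X * wDec q l) := by
  by_cases h : l 0 = 0
  · rw [if_pos h, ← if_pos (t := wAll l) (e := wGe q l + X * wDec q l) h, ← wtL_enlarge hq hi hi']
    exact wt_congr fun f hf => and_iff_left_of_imp
      (firstDec_of_link_zero_imp (link_enlarge_zero_imp h hq hi') hf)
  · have H := restricts_enlarge l i hq hi hi'
    rw [wtL, sum_enlarge, if_neg h,
      H.wt_firstDec_of_link_zero ((link_enlarge_zero l i).2 (.inr h)) (partSum_add_one_ne_one h hq),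
      Nat.add_sub_cancel, pow_succ, mul_assoc]
    rfl

theorem partSum_enlarge_start (hi : i ≠ 0) : partSum (enlarge l i) i = partSum l i + 1 := by
  have : (i : ℕ) ≠ 0 := fun h => hi (Fin.ext h)
  rw [partSum_enlarge, if_neg (lt_irrefl _), if_pos (by omega)]

theorem partSum_enlarge_end : partSum (enlarge l i) (i + 1) = partSum l (i + 1) + 2 := by
  rw [partSum_enlarge, if_pos (by omega), if_pos (by omega)]

theorem wBlock_enlarge (hi : i ≠ 0) : wBlock i (enlarge l i) =
    (if l 0 = 0 then wAll l else wGe i l + X * wDec i l) +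
      if l i = 0 then 0 else
        X * (if l 0 = 0 then wAll l else wGe (i + 1) l + X * wDec (i + 1) l) := by
  have hi0 : (i : ℕ) ≠ 0 := fun h => hi (Fin.ext h)
  have hs := partSum_enlarge_start (l := l) hi
  have he := partSum_enlarge_end (l := l) (i := i)
  have hl := partSum_succ l i
  have h1 := wtL_enlarge (l := l) (i := i) (q := i) (by omega) le_rfl (by omega)
  rw [if_neg (link_enlarge_start l i hi), pow_zero, one_mul] at h1
  rw [← h1]
  split_ifs with h h0
  · rw [add_zero]
    exact wt_congr fun f _ => by omega
  all_goals
    have h2 := wtL_enlarge (l := l) (i := i) (q := i + 1) (by omega) (by omega) le_rfl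
    rw [if_pos (link_enlarge_end l i (.inr h)), pow_one] at h2
    simp only [h0, if_true, if_false] at h2
    rw [← h2]
    refine wt_add (fun f hf => ⟨fun hb => ?_, fun hb => by omega⟩) (fun f hf => by omega)
    have := eq_or_eq_of_mem_block hf (by omega) hb.1 hb.2
    omega

theorem wBlockDec_enlarge (hi : i ≠ 0) : wBlockDec i (enlarge l i) =
    (if l 0 = 0 then wAll l else X * wDec i l) +
      if l i = 0 then 0 else
        X * (if l 0 = 0 then wAll l else X * wDec (i + 1) l) := by
  have hi0 : (i : ℕ) ≠ 0 := fun h => hi (Fin.ext h)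
  have hs := partSum_enlarge_start (l := l) hi
  have he := partSum_enlarge_end (l := l) (i := i)
  have hl := partSum_succ l i
  have h1 := wtL_enlarge_firstDec (l := l) (i := i) (q := i) (by omega) le_rfl (by omega)
  rw [if_neg (link_enlarge_start l i hi), pow_zero, one_mul] at h1
  rw [← h1]
  split_ifs with h h0
  · rw [add_zero]
    exact wt_congr fun f _ => and_congr_left fun _ => by omega
  all_goals
    have h2 := wtL_enlarge_firstDec (l := l) (i := i) (q := i + 1) (by omega) (by omega) le_rfl
    rw [if_pos (link_enlarge_end l i (.inr h)), pow_one] at h2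
    simp only [h0, if_true, if_false] at h2
    rw [← h2]
    refine wt_add (fun f hf => ?_) (fun f hf => by omega)
    rw [← or_and_right]
    refine and_congr_left fun _ => ⟨fun hb => ?_, fun hb => by omega⟩
    have := eq_or_eq_of_mem_block hf (by omega) hb.1 hb.2
    omega

end Insert

section Fixed

variable {k : ℕ} (l : Fin (k + 1) → ℕ)

theorem wtL_fixed :
    wtL (l + Pi.single 0 1) (fun g => g 0 = 0) = wAll l := by
  have hsum : ∑ a, (l + Pi.single 0 1 : Fin (k + 1) → ℕ) a = (∑ a, l a) + 1 := by
    rw [← partSum_of_le _ le_rfl, partSum_add_single, partSum_of_le _ le_rfl,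
      Fin.val_zero, if_pos (show 0 < k + 1 by omega)]
  rw [wtL, hsum]
  refine wt_fixed fun r => ?_
  rw [link, link, hsum]
  refine and_congr (by omega) (forall_congr' fun j => not_congr ?_)
  rw [partSum_add_single, Fin.val_zero]
  rcases Nat.eq_zero_or_pos j with rfl | hj
  · simp [partSum_zero]
  · rw [if_pos hj]
    omega

theorem partSum_single_one : partSum (l + Pi.single 0 1) 1 = l 0 + 1 := by
  rw [partSum_add_single, partSum_one]
  rfl

theorem wtL_fixed_firstDec :
    wtL (l + Pi.single 0 1) (fun g => g 0 = 0 ∧ FirstDec (link (l + Pi.single 0 1)) g) =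
      if l 0 = 0 then wAll l else 0 := by
  have h1 := partSum_single_one l
  split_ifs with h
  · rw [← wtL_fixed]
    refine wt_congr fun f _ => and_iff_left_of_imp fun _ hA => ?_
    exact absurd (h1.trans (by rw [h])) (hA.2 1)
  · refine wt_false fun f _ hf => ?_
    have := hf.2 ⟨?_, fun j hj => ?_⟩
    · omega
    · have := partSum_le (l + Pi.single 0 1) 1
      omega
    · rcases Nat.eq_zero_or_pos j with rfl | hpos
      · simp [partSum_zero] at hj
      · have := partSum_mono (l + Pi.single 0 1) (show 1 ≤ j from hpos)
        omega

/-- If the first segment is a single position and the first entry lies in it, then this entry is a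
fixed point. -/
theorem wBlock_zero_of_eq_zero (h : l 0 = 0) : wBlock 0 (l + Pi.single 0 1) = wAll l := by
  have h1 := partSum_single_one l
  rw [← wtL_fixed]
  exact wt_congr fun f _ => by rw [partSum_zero, zero_add]; omega

theorem wBlockDec_zero_of_eq_zero (h : l 0 = 0) : wBlockDec 0 (l + Pi.single 0 1) = wAll l := by
  have h1 := partSum_single_one l
  rw [← if_pos (c := l 0 = 0) (t := wAll l) (e := (0 : ℚ[X])) h, ← wtL_fixed_firstDec]
  exact wt_congr fun f _ => and_congr_left fun _ => by rw [partSum_zero, zero_add]; omega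

theorem wBlock_zero_enlarge : wBlock 0 (enlarge l 0) = wAll (l + Pi.single 0 1) +
    X * (if l 0 = 0 then wAll l else wGe 1 l + X * wDec 1 l) := by
  have he := partSum_enlarge_end (l := l) (i := 0)
  have h2 := wtL_enlarge (l := l) (i := 0) (q := 1) one_pos zero_le_one le_rfl
  rw [if_pos (c := link (enlarge l 0) (partSum l 1)) (link_enlarge_end l 0 (.inl rfl)),
    pow_one] at h2
  rw [← h2, ← wtL_fixed]
  refine wt_add (fun f hf => ?_) (fun f hf => by omega)
  rw [partSum_zero]
  refine ⟨fun hb => ?_, fun hb => ⟨by omega, ?_⟩⟩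
  · by_cases h0 : f 0 = 0
    · exact .inl h0
    · have := eq_or_eq_of_mem_block hf (i := 0) h0 (by rw [partSum_zero]; omega) hb.2
      rw [partSum_zero] at this
      simp only [Fin.val_zero, zero_add] at *
      omega
  · simp only [Fin.val_zero, zero_add] at *
    omega

theorem wBlockDec_zero_enlarge : wBlockDec 0 (enlarge l 0) =
    X * (if l 0 = 0 then wAll l else X * wDec 1 l) := by
  have he := partSum_enlarge_end (l := l) (i := 0)
  have h2 := wtL_enlarge_firstDec (l := l) (i := 0) (q := 1) one_pos zero_le_one le_rfl
  rw [if_pos (c := link (enlarge l 0) (partSum l 1)) (link_enlarge_end l 0 (.inl rfl)),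
    pow_one] at h2
  rw [← h2]
  refine wt_congr fun f hf => and_congr_left fun hF => ?_
  have h0 : f 0 ≠ 0 := fun h0 => by
    have := hF ((link_enlarge_zero l 0).2 (.inl rfl))
    omega
  rw [partSum_zero]
  refine ⟨fun hb => ?_, fun hb => ⟨by omega, ?_⟩⟩
  · have := eq_or_eq_of_mem_block hf (i := 0) h0 (by rw [partSum_zero]; omega) hb.2
    rw [partSum_zero] at this
    simp only [Fin.val_zero, zero_add] at *
    omega
  · simp only [Fin.val_zero, zero_add] at *
    omega

end Fixed

/-! ### Generating functions -/

/-- The power series `∑_l x^l W(l)`, where `l` runs over all exponent vectors and the variable of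
the polynomial `W l` is read as `t`. -/
noncomputable def asm {k : ℕ} (W : (Fin k → ℕ) → ℚ[X]) : Series k :=
  fun m => (W fun i => m (some i)).coeff (m none)

/-- The power series `∑_l x^l W(l)`, where `l` runs over the compositions with positive parts. -/
noncomputable def gen {k : ℕ} (W : (Fin k → ℕ) → ℚ[X]) : Series k :=
  asm fun l => if ∀ i, 0 < l i then W l else 0

section Asm

variable {k : ℕ}

theorem coeff_asm (W : (Fin k → ℕ) → ℚ[X]) (m : Option (Fin k) →₀ ℕ) :
    MvPowerSeries.coeff m (asm W) = (W fun i => m (some i)).coeff (m none) := rfl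

theorem asm_add (V W : (Fin k → ℕ) → ℚ[X]) : asm V + asm W = asm fun l => V l + W l := by
  ext m
  simp [coeff_asm]

theorem t_mul_asm (W : (Fin k → ℕ) → ℚ[X]) : t * asm W = asm fun l => X * W l := by
  ext m
  rw [t, MvPowerSeries.X, MvPowerSeries.coeff_monomial_mul, coeff_asm, coeff_asm]
  split_ifs with h
  · have h1 : 1 ≤ m none := by simpa using h none
    obtain ⟨d, hd⟩ := Nat.exists_eq_add_of_le' h1
    rw [hd, coeff_X_mul, one_mul]
    simp [hd]
  · have h1 : m none = 0 := by
      by_contra hc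
      exact h (Finsupp.single_le_iff.2 (Nat.pos_of_ne_zero hc))
    rw [h1, coeff_X_mul_zero]

theorem asm_eq_x_mul {V W : (Fin k → ℕ) → ℚ[X]} {i : Fin k} (h0 : ∀ l, l i = 0 → V l = 0)
    (h1 : ∀ l, V (l + Pi.single i 1) = W l) : asm V = x i * asm W := by
  ext m
  rw [x, MvPowerSeries.X, MvPowerSeries.coeff_monomial_mul, coeff_asm]
  split_ifs with h
  · rw [one_mul, coeff_asm, ← h1]
    have h1 : 1 ≤ m (some i) := Finsupp.single_le_iff.1 h
    have h2 : (fun j => m (some j)) =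
        (fun j => (m - Finsupp.single (some i) 1 : Option (Fin k) →₀ ℕ) (some j)) +
          Pi.single i 1 := by
      funext j
      by_cases hj : j = i
      · subst hj
        simp
        omega
      · simp [hj]
    rw [h2]
    simp
  · rw [h0, coeff_zero]
    by_contra hc
    exact h (Finsupp.single_le_iff.2 (Nat.pos_of_ne_zero hc))

theorem hat_asm (i : Fin (k + 1)) (W : (Fin k → ℕ) → ℚ[X]) :
    hat i (asm W) = asm fun l => if l i = 0 then W (l ∘ i.succAbove) else 0 := by
  let e : Option (Fin k) ↪ Option (Fin (k + 1)) := i.succAboveEmb.optionMap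
  ext m
  rw [coeff_asm]
  split_ifs with h
  · have hm : Finsupp.embDomain e (m.comapDomain e e.injective.injOn) = m := by
      refine Finsupp.embDomain_comapDomain fun a ha => ?_
      cases a with
      | none => exact ⟨none, rfl⟩
      | some a =>
        have : a ≠ i := fun h' => by simp [h', h] at ha
        obtain ⟨b, hb⟩ := Fin.exists_succAbove_eq this
        exact ⟨some b, congrArg some hb⟩
    have := MvPowerSeries.coeff_embDomain_rename e (asm W) (m.comapDomain e e.injective.injOn)
    rw [hm] at this
    exact this
  · rw [coeff_zero]
    refine MvPowerSeries.coeff_rename_eq_zero _ _ ?_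
    rintro ⟨m', rfl⟩
    refine h (Finsupp.mapDomain_of_notMem_range _ _ ?_)
    rintro ⟨a, ha⟩
    cases a with
    | none => simp at ha
    | some a => exact Fin.succAbove_ne i a (Option.some.inj ha)

theorem gen_congr {V W : (Fin k → ℕ) → ℚ[X]} (h : ∀ l, (∀ i, 0 < l i) → V l = W l) :
    gen V = gen W := by
  unfold gen
  congr 1
  funext l
  split_ifs with hl
  · exact h l hl
  · rfl

theorem gen_add (V W : (Fin k → ℕ) → ℚ[X]) : gen V + gen W = gen fun l => V l + W l := by
  unfold gen
  rw [asm_add]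
  congr 1
  funext l
  split_ifs
  · rfl
  · exact add_zero _

theorem gen_zero : gen (fun _ : Fin k → ℕ => 0) = 0 := by
  ext m
  simp [gen, coeff_asm]

end Asm

section Recurrence

variable {k : ℕ}

theorem pos_iff_succAbove (l : Fin (k + 1) → ℕ) (i : Fin (k + 1)) :
    (∀ r, 0 < l r) ↔ l i ≠ 0 ∧ ∀ r, 0 < (l ∘ i.succAbove) r := by
  rw [Fin.forall_iff_succAbove i, Nat.pos_iff_ne_zero]
  rfl

theorem comp_succAbove_comm (l : Fin (k + 2) → ℕ) (i : Fin (k + 1)) :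
    (l ∘ i.succ.succAbove) ∘ Fin.succAbove 0 = (l ∘ Fin.succAbove 0) ∘ i.succAbove := by
  funext r
  simp

theorem pos_enlarge_iff (l : Fin (k + 2) → ℕ) (i : Fin (k + 1)) :
    (∀ r, 0 < enlarge l i.succ r) ↔ ∀ r, 0 < ((l ∘ Fin.succAbove 0) ∘ i.succAbove) r := by
  rw [pos_iff_succAbove _ 0, pos_iff_succAbove _ i]
  have h1 : enlarge l i.succ 0 ≠ 0 := by simp [enlarge]
  have h2 : (enlarge l i.succ ∘ Fin.succAbove 0) i ≠ 0 := by simp [enlarge]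
  rw [and_iff_right h1, and_iff_right h2]
  refine forall_congr' fun r => ?_
  have : (i.succAbove r).succ ≠ i.succ := fun h => Fin.succAbove_ne i r (Fin.succ_injective _ h)
  simp [enlarge, this]

theorem asm_eq_x_mul_x {V W : (Fin (k + 2) → ℕ) → ℚ[X]} {i : Fin (k + 1)}
    (h0 : ∀ l, l 0 = 0 ∨ l i.succ = 0 → V l = 0) (h1 : ∀ l, V (enlarge l i.succ) = W l) :
    asm V = x 0 * x i.succ * asm W := by
  rw [mul_assoc, ← asm_eq_x_mul (V := fun l => V (l + Pi.single 0 1)) (W := W)]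
  · exact asm_eq_x_mul (fun l h => h0 l (.inl h)) fun l => rfl
  · intro l h
    exact h0 _ (.inr (by simp [h]))
  · exact h1

/-- The first entry lies in a later segment. The series in fewer variables account for the cases in
which the first segment, the segment of the first entry, or both are single positions. -/
theorem gen_wBlock (i : Fin (k + 1)) : gen (wBlock (i + 1)) = x 0 * x i.succ *
    (t * hat 0 (gen wAll) + hat 0 (gen wAll) + hat i.succ (gen (wGe (i + 1)))
      + t * hat i.succ (gen (wDec (i + 1))) + hat₁ i (gen wAll)
      + t * gen (wGe (i + 2)) + t * (t * gen (wDec (i + 2)))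
      + gen (wGe (i + 1)) + t * gen (wDec (i + 1))) := by
  simp only [gen, hat₁, hat_asm, t_mul_asm, asm_add]
  refine asm_eq_x_mul_x (fun l h => ?_) fun l => ?_
  · refine if_neg fun h' => ?_
    have := h' 0
    have := h' i.succ
    omega
  · have hB := wBlock_enlarge (l := l) (i := i.succ) (Fin.succ_ne_zero i)
    rw [Fin.val_succ] at hB
    have hi : (l ∘ Fin.succAbove 0) i = l i.succ := by simp
    have hi0 : (l ∘ i.succ.succAbove) 0 = l 0 := by simp
    rw [hB, if_congr (pos_enlarge_iff l i) rfl rfl, if_congr (pos_iff_succAbove l 0) rfl rfl]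
    simp only [pos_iff_succAbove l 0, pos_iff_succAbove (l ∘ Fin.succAbove 0) i,
      pos_iff_succAbove (l ∘ i.succ.succAbove) 0, comp_succAbove_comm, hi, hi0]
    by_cases hO : ∀ r, 0 < ((l ∘ Fin.succAbove 0) ∘ i.succAbove) r
    · by_cases h0 : l 0 = 0 <;> by_cases h1 : l i.succ = 0 <;>
        simp only [h0, h1, hO, if_true, if_false, ne_eq, not_true_eq_false, not_false_eq_true,
          and_true, and_false, implies_true, mul_zero, add_zero, zero_add]
      · rw [wAll_succAbove (by simpa using h1), wAll_succAbove h0]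
      · rw [wAll_succAbove h0, add_comm]
      · rw [wGe_succAbove h1 (by simp), wDec_succAbove h1 (by simp)]
      · ring
    · simp only [hO, and_false, if_false, mul_zero, ite_self, add_zero]

theorem gen_wBlockDec (i : Fin (k + 1)) : gen (wBlockDec (i + 1)) = x 0 * x i.succ *
    (t * hat 0 (gen wAll) + hat 0 (gen wAll)
      + t * hat i.succ (gen (wDec (i + 1))) + hat₁ i (gen wAll)
      + t * (t * gen (wDec (i + 2))) + t * gen (wDec (i + 1))) := by
  simp only [gen, hat₁, hat_asm, t_mul_asm, asm_add]
  refine asm_eq_x_mul_x (fun l h => ?_) fun l => ?_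
  · refine if_neg fun h' => ?_
    have := h' 0
    have := h' i.succ
    omega
  · have hB := wBlockDec_enlarge (l := l) (i := i.succ) (Fin.succ_ne_zero i)
    rw [Fin.val_succ] at hB
    have hi : (l ∘ Fin.succAbove 0) i = l i.succ := by simp
    have hi0 : (l ∘ i.succ.succAbove) 0 = l 0 := by simp
    rw [hB, if_congr (pos_enlarge_iff l i) rfl rfl, if_congr (pos_iff_succAbove l 0) rfl rfl]
    simp only [pos_iff_succAbove l 0, pos_iff_succAbove (l ∘ Fin.succAbove 0) i,
      pos_iff_succAbove (l ∘ i.succ.succAbove) 0, comp_succAbove_comm, hi, hi0]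
    by_cases hO : ∀ r, 0 < ((l ∘ Fin.succAbove 0) ∘ i.succAbove) r
    · by_cases h0 : l 0 = 0 <;> by_cases h1 : l i.succ = 0 <;>
        simp only [h0, h1, hO, if_true, if_false, ne_eq, not_true_eq_false, not_false_eq_true,
          and_true, and_false, implies_true, mul_zero, add_zero, zero_add]
      · rw [wAll_succAbove (by simpa using h1), wAll_succAbove h0]
      · rw [wAll_succAbove h0, add_comm]
      · rw [wDec_succAbove h1 (by simp)]
      · ring
    · simp only [hO, and_false, if_false, mul_zero, ite_self, add_zero]

theorem asm_eq_x_mul_add {U V W : (Fin (k + 1) → ℕ) → ℚ[X]} (h0 : ∀ l, l 0 = 0 → V l = 0)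
    (h1 : ∀ l, l 0 = 0 → V (l + Pi.single 0 1) = U l)
    (h2 : ∀ l, V (enlarge l 0) = U (l + Pi.single 0 1) + W l) :
    asm V = x 0 * (asm U + x 0 * asm W) := by
  rw [← asm_eq_x_mul (V := fun l => V (l + Pi.single 0 1) - U l) (W := W), asm_add]
  · exact asm_eq_x_mul h0 fun l => by ring
  · exact fun l h => by rw [h1 l h, sub_self]
  · exact fun l => by rw [show l + Pi.single 0 1 + Pi.single 0 1 = enlarge l 0 from rfl, h2]; ring

theorem pos_add_single_iff (l : Fin (k + 1) → ℕ) :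
    (∀ r, 0 < (l + Pi.single 0 1 : Fin (k + 1) → ℕ) r) ↔
    ∀ r, 0 < (l ∘ Fin.succAbove 0) r := by
  rw [pos_iff_succAbove _ 0]
  simp

theorem pos_enlarge_zero_iff (l : Fin (k + 1) → ℕ) : (∀ r, 0 < enlarge l 0 r) ↔
    ∀ r, 0 < (l ∘ Fin.succAbove 0) r := by
  rw [enlarge, pos_add_single_iff]
  simp

/-- The first entry lies in the first segment: it is a fixed point, or it is exchanged with the last
position of the segment. -/
theorem gen_wBlock_zero : gen (wBlock (k := k + 1) 0) = x 0 * (gen wAll + hat 0 (gen wAll)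
    + x 0 * (t * hat 0 (gen wAll) + t * gen (wGe 1) + t * (t * gen (wDec 1)))) := by
  simp only [gen, hat_asm, t_mul_asm, asm_add]
  refine asm_eq_x_mul_add (fun l h => ?_) (fun l h => ?_) fun l => ?_
  · exact if_neg fun h' => (h' 0).ne' h
  · rw [if_congr (pos_add_single_iff l) rfl rfl, if_congr (pos_iff_succAbove l 0) rfl rfl,
      wBlock_zero_of_eq_zero l h, wAll_succAbove h]
    simp [h]
  · rw [if_congr (pos_enlarge_zero_iff l) rfl rfl, if_congr (pos_add_single_iff l) rfl rfl,
      wBlock_zero_enlarge]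
    simp only [pos_iff_succAbove l 0]
    by_cases hO : ∀ r, 0 < (l ∘ Fin.succAbove 0) r
    · by_cases h0 : l 0 = 0 <;> simp [h0, hO, -Fin.succAbove_zero, -Function.comp_apply]
      · rw [wAll_succAbove h0]
      · ring
    · simp [hO, -Fin.succAbove_zero, -Function.comp_apply]

theorem gen_wBlockDec_zero : gen (wBlockDec (k := k + 1) 0) = x 0 * (hat 0 (gen wAll)
    + x 0 * (t * hat 0 (gen wAll) + t * (t * gen (wDec 1)))) := by
  simp only [gen, hat_asm, t_mul_asm, asm_add]
  refine asm_eq_x_mul_add (fun l h => ?_) (fun l h => ?_) fun l => ?_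
  · exact if_neg fun h' => (h' 0).ne' h
  · rw [if_congr (pos_add_single_iff l) rfl rfl, wBlockDec_zero_of_eq_zero l h, wAll_succAbove h]
    simp [h]
  · rw [if_congr (pos_enlarge_zero_iff l) rfl rfl, wBlockDec_zero_enlarge]
    simp only [pos_iff_succAbove l 0]
    by_cases hO : ∀ r, 0 < (l ∘ Fin.succAbove 0) r
    · by_cases h0 : l 0 = 0 <;> simp [h0, hO, -Fin.succAbove_zero, -Function.comp_apply]
      · rw [wAll_succAbove h0]
    · simp [hO, -Fin.succAbove_zero, -Function.comp_apply]

end Recurrence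

/-! ### From permutations to involutions of the natural numbers -/

section Segments

variable {k : ℕ} {l : Fin k → ℕ}

theorem exists_segment {r : ℕ} (hr : r < ∑ i, l i) :
    ∃ i : Fin k, partSum l i ≤ r ∧ r < partSum l (i + 1) := by
  classical
  have hex : ∃ j, r < partSum l j := ⟨k, by rwa [partSum_of_le l le_rfl]⟩
  obtain ⟨j, hj⟩ : ∃ j, Nat.find hex = j + 1 := Nat.exists_eq_succ_of_ne_zero fun h => by
    have := Nat.find_spec hex
    rw [h, partSum_zero] at this
    omega
  have h1 := Nat.find_spec hex
  have h2 := Nat.find_min hex (m := j) (by omega)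
  rw [hj] at h1
  have hjk : j < k := by
    by_contra hc
    rw [partSum_of_le l (by omega)] at h2
    exact h2 hr
  exact ⟨⟨j, hjk⟩, not_lt.1 h2, h1⟩

theorem link_iff_of_segment {i r : ℕ} (h : partSum l i ≤ r) (h' : r < partSum l (i + 1)) :
    link l r ↔ r + 1 < partSum l (i + 1) := by
  constructor
  · intro hl
    have := hl.2 (i + 1)
    omega
  · intro h''
    refine ⟨h''.trans_le (partSum_le l _), fun j hj => ?_⟩
    rcases le_or_gt j i with hji | hji
    · have := partSum_mono l hji
      omega
    · have := partSum_mono l (show i + 1 ≤ j from hji)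
      omega

end Segments

/-- On an interval, a sequence that is strictly decreasing after its first descent is strictly
increasing up to the place of its maximum and strictly decreasing from there on. -/
theorem exists_peak {f : ℕ → ℕ} (hf : Function.Injective f) {a b : ℕ} (hab : a < b)
    (h : ∀ r, a ≤ r → r + 2 < b → f (r + 1) < f r → f (r + 2) < f (r + 1)) :
    ∃ p, a ≤ p ∧ p < b ∧ (∀ r r', a ≤ r → r < r' → r' ≤ p → f r < f r') ∧
      ∀ r r', p ≤ r → r < r' → r' < b → f r' < f r := by
  have hdesc : ∀ r, a ≤ r → f (r + 1) < f r → ∀ r', r < r' → r' < b → f r' < f (r' - 1) := by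
    intro r hr hlt r' hr'
    induction r', hr' using Nat.le_induction with
    | base => exact fun _ => hlt
    | succ s hs ih =>
      intro hb
      obtain ⟨q, rfl⟩ : ∃ q, s = q + 1 := ⟨s - 1, by omega⟩
      exact h q (by omega) (by omega) (ih (by omega))
  have hdesc' : ∀ r, a ≤ r → f (r + 1) < f r → ∀ r', r < r' → r' < b → f r' < f r := by
    intro r hr hlt r' hr'
    induction r', hr' using Nat.le_induction with
    | base => exact fun _ => hlt
    | succ s hs ih =>
      intro hb
      exact (hdesc r hr hlt (s + 1) (by omega) hb).trans (ih (by omega))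
  obtain ⟨p, hp, hmax⟩ := Finset.exists_max_image (Finset.Ico a b) f ⟨a, by simpa using hab⟩
  simp only [Finset.mem_Ico, and_imp] at hp hmax
  refine ⟨p, hp.1, hp.2, fun r r' hr hr' => ?_, fun r r' hr hr' hb => ?_⟩
  · induction r', hr' using Nat.le_induction with
    | base =>
      intro hp'
      by_contra hc
      have hlt : f (r + 1) < f r := lt_of_le_of_ne (not_lt.1 hc) fun h' => by
        have := hf h'
        omega
      exact absurd (hdesc' r hr hlt p (by omega) hp.2) (not_lt.2 (hmax r hr (by omega)))
    | succ s hs ih =>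
      intro hp'
      refine (ih (by omega)).trans ?_
      by_contra hc
      have hlt : f (s + 1) < f s := lt_of_le_of_ne (not_lt.1 hc) fun h' => by
        have := hf h'
        omega
      exact absurd (hdesc' s (by omega) hlt p (by omega) hp.2)
        (not_lt.2 (hmax s (by omega) (by omega)))
  · have hlt : ∀ s, p < s → s < b → f s < f p := fun s hs hs' =>
      lt_of_le_of_ne (hmax s (by omega) hs') fun h' => by
        have := hf h'
        omega
    rcases Nat.eq_or_lt_of_le hr with rfl | hr
    · exact hlt r' hr' hb
    · have hp1 := hlt (p + 1) (by omega) (by omega)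
      refine hdesc' r (by omega) ?_ r' hr' hb
      exact hdesc p hp.1 hp1 (r + 1) (by omega) (by omega)

section Perm

variable {n : ℕ}

/-- The permutation `π` of `{0, …, n - 1}`, extended to `ℕ` by the identity. -/
def extend (π : Equiv.Perm (Fin n)) (i : ℕ) : ℕ := if h : i < n then π ⟨i, h⟩ else i

theorem extend_of_lt (π : Equiv.Perm (Fin n)) {i : ℕ} (h : i < n) : extend π i = π ⟨i, h⟩ :=
  dif_pos h

theorem extend_val (π : Equiv.Perm (Fin n)) (p : Fin n) : extend π p = π p := extend_of_lt π p.2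

theorem extend_injective : Function.Injective (extend (n := n)) := by
  intro π σ h
  ext p
  rw [← extend_val, h, extend_val]

theorem inv_extend_iff (π : Equiv.Perm (Fin n)) : Inv n (extend π) ↔ π⁻¹ = π := by
  have h1 : ∀ p, extend π (extend π (p : Fin n)) = π (π p) := fun p => by
    rw [extend_val, extend_val]
  rw [inv_eq_iff_mul_eq_one]
  constructor
  · intro h
    ext p
    rw [Equiv.Perm.mul_apply, ← h1, h.1]
    rfl
  · intro h
    refine ⟨fun i => ?_, fun i hi => dif_neg (by omega)⟩
    by_cases hi : i < n
    · have := h1 ⟨i, hi⟩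
      rw [← Equiv.Perm.mul_apply, h] at this
      exact this
    · rw [extend, extend, dif_neg hi, dif_neg hi]

theorem exists_extend {f : ℕ → ℕ} (hf : Inv n f) : ∃ π : Equiv.Perm (Fin n), extend π = f := by
  refine ⟨⟨fun p => ⟨f p, hf.lt p.2⟩, fun p => ⟨f p, hf.lt p.2⟩, fun p => ?_, fun p => ?_⟩, ?_⟩
  · simp [hf.1]
  · simp [hf.1]
  · funext i
    by_cases hi : i < n
    · rw [extend_of_lt _ hi]
      rfl
    · rw [extend, dif_neg hi, hf.2 i (by omega)]

theorem extend_fun_injective (π : Equiv.Perm (Fin n)) : Function.Injective (extend π) := by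
  intro i j h
  unfold extend at h
  split_ifs at h with h1 h2 h2
  · simpa using π.injective (Fin.ext h)
  · have := (π ⟨i, h1⟩).2
    omega
  · have := (π ⟨j, h2⟩).2
    omega
  · exact h

variable {k : ℕ} {l : Fin k → ℕ}

theorem isUnimodal_iff (hl : ∀ i, 0 < l i) (π : Equiv.Perm (Fin (∑ i, l i))) :
    IsUnimodal l π ↔ Unim (link l) (extend π) := by
  constructor
  · intro h r hr hr' hlt
    have hrn : r < ∑ i, l i := (Nat.lt_succ_self r).trans hr.1
    obtain ⟨i, hi, hi'⟩ := exists_segment hrn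
    have h1 := (link_iff_of_segment hi hi').1 hr
    have h2 := (link_iff_of_segment (by omega) h1).1 hr'
    obtain ⟨p, hp, hmono, hanti⟩ := h i
    have e0 := extend_of_lt π hrn
    have e1 := extend_of_lt π hr.1
    have e2 := extend_of_lt π hr'.1
    rw [e0, e1] at hlt
    rw [e1, show extend π (r + 2) = _ from e2]
    by_cases hpr : r + 1 ≤ p
    · have := hmono (a := ⟨r, hrn⟩) (b := ⟨r + 1, hr.1⟩) ⟨⟨hi, hi'⟩, Fin.le_def.2 (by simp; omega)⟩
        ⟨⟨Nat.le_succ_of_le hi, h1⟩, Fin.le_def.2 hpr⟩ (Fin.lt_def.2 (Nat.lt_succ_self r))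
      exact absurd hlt (not_lt.2 (Fin.lt_def.1 this).le)
    · exact hanti (a := ⟨r + 1, hr.1⟩) (b := ⟨r + 1 + 1, hr'.1⟩)
        ⟨⟨Nat.le_succ_of_le hi, h1⟩, Fin.le_def.2 (by simp; omega)⟩
        ⟨⟨Nat.le_succ_of_le (Nat.le_succ_of_le hi), h2⟩, Fin.le_def.2 (by simp; omega)⟩
        (Fin.lt_def.2 (Nat.lt_succ_self _))
  · intro h i
    have hs := partSum_succ l i
    have hle := partSum_le l (i + 1)
    have hli := hl i
    obtain ⟨p, hp, hp', hmono, hanti⟩ := exists_peak (extend_fun_injective π)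
      (a := partSum l i) (b := partSum l (i + 1)) (by omega) fun r hr hr' hlt =>
        h r ((link_iff_of_segment (i := i) hr (by omega)).2 (by omega))
          ((link_iff_of_segment (i := i) (by omega) (by omega)).2 (by omega)) hlt
    refine ⟨⟨p, by omega⟩, ⟨hp, hp'⟩, fun a ha b hb hab => ?_, fun a ha b hb hab => ?_⟩
    · have := hmono a b ha.1.1 hab (Fin.le_def.1 hb.2)
      rwa [extend_val, extend_val] at this
    · have := hanti a b (Fin.le_def.1 ha.2) hab hb.1.2
      rwa [extend_val, extend_val] at this

theorem desL_eq (π : Equiv.Perm (Fin (∑ i, l i))) :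
    desL l π = (desSet (link l) (extend π)).ncard := by
  rw [desL, ← Set.ncard_image_of_injective (desSet (link l) (extend π)) Nat.succ_injective]
  congr 1
  ext s
  constructor
  · rintro ⟨⟨p, q, rfl, hq, hlt⟩, hs⟩
    refine ⟨p, ⟨⟨by have := q.2; omega, fun j hj => ?_⟩, ?_⟩, rfl⟩
    · refine hs ⟨j, ?_, ?_, hj.symm⟩
      · by_contra hc
        rw [show j = 0 by omega, partSum_zero] at hj
        omega
      · by_contra hc
        rw [partSum_of_le l (by omega)] at hj
        have := q.2
        omega
    · rw [← hq, extend_val, extend_val]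
      exact hlt
  · rintro ⟨r, ⟨hr, hlt⟩, rfl⟩
    have hr1 := hr.1
    refine ⟨⟨⟨r, by omega⟩, ⟨r + 1, hr1⟩, rfl, rfl, ?_⟩, ?_⟩
    · rwa [extend_of_lt π hr1, extend_of_lt π (by omega : r < _)] at hlt
    · rintro ⟨j, -, -, hj⟩
      exact hr.2 j hj.symm

theorem firstEntry_eq (π : Equiv.Perm (Fin n)) (h : 0 < n) : firstEntry π = extend π 0 + 1 := by
  rw [firstEntry, dif_pos h, extend_of_lt π h]

theorem firstDecreasing_iff {l : Fin (k + 1) → ℕ} (hl : 0 < l 0)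
    {π : Equiv.Perm (Fin (∑ i, l i))}
    (hU : Unim (link l) (extend π)) : FirstDecreasing l π ↔ FirstDec (link l) (extend π) := by
  have h0 := partSum_zero l
  have hle := partSum_le l 1
  constructor
  · intro h hA
    have h1 := hA.2 1
    have h2 := hA.1
    have h3 := partSum_one l
    rw [extend_of_lt π h2, extend_of_lt π (by omega : 0 < _)]
    exact h 0 rfl (a := ⟨0, by omega⟩) (b := ⟨0 + 1, h2⟩)
      ⟨by simp [h0], by simp; omega⟩ ⟨by simp [h0], by simp; omega⟩ (Fin.lt_def.2 one_pos)
  · intro h i hi a ha b hb hab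
    have hb' := hb.2
    rw [hi] at hb'
    have key : ∀ r, r + 1 < partSum l 1 → extend π (r + 1) < extend π r := by
      intro r
      induction r with
      | zero => exact fun hr => h ((link_iff_of_segment (i := 0) (by omega) (by omega)).2 hr)
      | succ r ih =>
        intro hr
        exact hU r ((link_iff_of_segment (i := 0) (by omega) (by simp; omega)).2 (by simp; omega))
          ((link_iff_of_segment (i := 0) (by omega) (by simp; omega)).2 (by simpa using hr))
          (ih (by omega))
    have key' : ∀ r', (a : ℕ) < r' → r' < partSum l 1 → extend π r' < extend π a := by
      intro r' hr'
      induction r', hr' using Nat.le_induction with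
      | base => exact fun h' => key a h'
      | succ s hs ih => exact fun h' => (key s h').trans (ih (by omega))
    have := key' b hab (by simpa using hb')
    rwa [extend_val, extend_val] at this

theorem genFun_eq_gen (P : (l : Fin k → ℕ) → Set (Equiv.Perm (Fin (∑ i, l i))))
    (Q : (Fin k → ℕ) → (ℕ → ℕ) → Prop)
    (h : ∀ l, (∀ i, 0 < l i) → ∀ π, π ∈ P l ↔ π ∈ setI l ∧ Q l (extend π)) :
    genFun k P = gen fun l => wtL l (Q l) := by
  ext m
  rw [gen, coeff_asm, MvPowerSeries.coeff_apply, genFun]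
  split_ifs with hl
  · set l : Fin k → ℕ := fun i => m (some i)
    rw [wtL, coeff_wt, ← Set.ncard_image_of_injective _ extend_injective]
    congr 2
    ext f
    constructor
    · rintro ⟨π, ⟨hπ, hd⟩, rfl⟩
      obtain ⟨⟨hinv, hU⟩, hQ⟩ := (h l hl π).1 hπ
      exact ⟨⟨(inv_extend_iff π).2 hinv, (isUnimodal_iff hl π).1 hU⟩, hQ, (desL_eq π).symm.trans hd⟩
    · rintro ⟨⟨hinv, hU⟩, hQ, hd⟩
      obtain ⟨π, rfl⟩ := exists_extend hinv
      exact ⟨π, ⟨(h l hl π).2 ⟨⟨(inv_extend_iff π).1 hinv, (isUnimodal_iff hl π).2 hU⟩, hQ⟩,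
        (desL_eq π).trans hd⟩, rfl⟩
  · rfl

theorem L_eq_gen (k : ℕ) : L k = gen wAll :=
  genFun_eq_gen _ _ fun l _ π => by rw [and_true]

theorem D_eq_gen (k j : ℕ) : D (k + 1) j = gen (wDec j) := by
  refine genFun_eq_gen _ _ fun l hl π => ?_
  have hn : 0 < ∑ i, l i := (hl 0).trans_le (Finset.single_le_sum (fun _ _ => Nat.zero_le _)
    (Finset.mem_univ 0))
  refine and_congr_right fun hπ => ?_
  rw [firstDecreasing_iff (hl 0) ((isUnimodal_iff hl π).1 hπ.2), firstEntry_eq π hn]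
  rfl

theorem Lj_eq_gen (k j : ℕ) : Lj (k + 1) j = gen (wDec j) + gen (wGe j) := by
  rw [gen_add, Lj, genFun_eq_gen _ (fun l f => (f 0 < partSum l j ∧ FirstDec (link l) f) ∨
    partSum l j ≤ f 0) fun l hl π => ?_]
  · congr 1
    funext l
    exact wt_add (fun f _ => Iff.rfl) fun f _ h h' => by omega
  · have hn : 0 < ∑ i, l i := (hl 0).trans_le (Finset.single_le_sum (fun _ _ => Nat.zero_le _)
      (Finset.mem_univ 0))
    refine and_congr_right fun hπ => ?_
    rw [firstDecreasing_iff (hl 0) ((isUnimodal_iff hl π).1 hπ.2), firstEntry_eq π hn,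
      Nat.lt_succ_iff]
    rfl

end Perm

/-! ### The recurrences as identities of power series -/

section Series

variable {k : ℕ}

theorem L_zero : L 0 = 1 := by
  have h : ∀ l : Fin 0 → ℕ, wAll l = 1 := fun l => by
    have hset : {f | f ∈ uinv (∑ i, l i) (link l) ∧ True} = {id} := by
      ext f
      constructor
      · rintro ⟨⟨hf, -⟩, -⟩
        funext i
        exact hf.2 i (by simp)
      · rintro rfl
        exact ⟨⟨⟨fun _ => rfl, fun _ _ => rfl⟩, fun r hr => absurd hr.1 (by simp)⟩, trivial⟩
    have hdes : desSet (link l) id = ∅ :=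
      Set.eq_empty_of_forall_notMem fun r hr => absurd hr.1.1 (by simp)
    rw [wAll, wtL, wt, hset, finsum_mem_singleton, hdes, Set.ncard_empty, pow_zero]
  ext m
  rw [L_eq_gen, gen, coeff_asm, if_pos (fun i => i.elim0), h, MvPowerSeries.coeff_one, coeff_one]
  refine if_congr ⟨fun h0 => ?_, fun h0 => by simp [h0]⟩ rfl rfl
  exact Finsupp.ext fun
    | none => h0
    | some a => a.elim0

theorem hat_add (i : Fin (k + 1)) (F G : Series k) : hat i (F + G) = hat i F + hat i G :=
  map_add _ F G

theorem gen_wGe (i : ℕ) : gen (wGe (k := k) i) = gen (wBlock i) + gen (wGe (i + 1)) := by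
  rw [gen_add]
  exact gen_congr fun l _ => wGe_eq_add i l

theorem gen_wDec_succ (i : ℕ) :
    gen (wDec (k := k) (i + 1)) = gen (wDec i) + gen (wBlockDec i) := by
  rw [gen_add]
  exact gen_congr fun l _ => wDec_succ i l

theorem gen_wDec_one : gen (wDec (k := k) 1) = gen (wBlockDec 0) := by
  rw [← zero_add 1, gen_wDec_succ, add_eq_right, ← gen_zero]
  exact gen_congr fun l _ => wDec_zero l

theorem gen_wAll : gen (wAll (k := k)) = gen (wBlock 0) + gen (wGe 1) := by
  rw [← zero_add 1, ← gen_wGe]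
  exact gen_congr fun l _ => (wGe_zero l).symm

theorem gen_wGe_self : gen (wGe (k := k + 1) (k + 1)) = 0 := by
  rw [← gen_zero]
  exact gen_congr fun l hl => wGe_self l <| (hl 0).trans_le
    (Finset.single_le_sum (fun _ _ => Nat.zero_le _) (Finset.mem_univ 0))

theorem sum_gen_wBlock (j : Fin (k + 1)) :
    ∑ i ∈ Finset.Ici j, gen (wBlock (k := k + 2) (i + 1)) = gen (wGe (j + 1)) := by
  have h1 : ∑ i ∈ Finset.Ici j, gen (wBlock (k := k + 2) (i + 1)) =
      ∑ i ∈ Finset.Ico (j : ℕ) (k + 1), gen (wBlock (k := k + 2) (i + 1)) := by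
    rw [← Fin.map_valEmbedding_Ici, Finset.sum_map]
    rfl
  have h2 : ∀ i, gen (wBlock (k := k + 2) (i + 1)) =
      -(gen (wGe (i + 1 + 1)) - gen (wGe (i + 1))) := fun i => by
    rw [gen_wGe (i + 1)]
    ring
  rw [h1, Finset.sum_congr rfl fun i _ => h2 i, Finset.sum_neg_distrib,
    Finset.sum_Ico_sub (fun i => gen (wGe (k := k + 2) (i + 1))) (by omega), gen_wGe_self]
  ring

theorem eq_inv_mul_of_mul_eq {F G H : Series k} (h : MvPowerSeries.constantCoeff G ≠ 0)
    (hF : G * F = H) : F = G⁻¹ * H := by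
  rw [← hF, ← mul_assoc, MvPowerSeries.inv_mul_cancel _ h, one_mul]

/-- Cancelling `1 + x_1 t` from the recurrence `(1 - x_1^2 t^2) D_1 = x_1 (1 + x_1 t) L(x̂_1)`. -/
theorem one_sub_mul_gen_wDec_one :
    (1 - x 0 * t) * gen (wDec (k := k + 1) 1) = x 0 * hat 0 (gen wAll) := by
  have h := gen_wBlockDec_zero (k := k)
  rw [← gen_wDec_one] at h
  have hc : MvPowerSeries.constantCoeff (1 + x 0 * t : Series (k + 1)) ≠ 0 := by simp [x, t]
  have hu : IsUnit (1 + x 0 * t : Series (k + 1)) :=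
    MvPowerSeries.isUnit_iff_constantCoeff.2 (isUnit_iff_ne_zero.2 hc)
  refine hu.mul_left_cancel ?_
  linear_combination h

/-- The bracket of the recurrences for `L` and `L_j`, summed up as a generating function. -/
theorem gen_wBlock_eq (i : Fin (k + 1)) : gen (wBlock (i + 1)) = x 0 * x i.succ *
    ((t + 1) * hat 0 (L (k + 1))
      + hat i.succ (Lj (k + 1) (i + 1))
      + (t - 1) * hat i.succ (D (k + 1) (i + 1))
      + hat₁ i (L k)
      + t * (Lj (k + 2) (i + 2) + (t - 1) * D (k + 2) (i + 2))
      + Lj (k + 2) (i + 1)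
      + (t - 1) * D (k + 2) (i + 1)) := by
  rw [gen_wBlock]
  simp only [L_eq_gen, Lj_eq_gen, D_eq_gen, hat_add]
  ring

end Series

end LambdaUnimodal

open LambdaUnimodal
theorem theorem4 :
    -- base cases `L^0` and `L^1`
    L 0 = 1 ∧
    L 1 = x 0 * ((1 - x 0) * (1 - x 0 * t))⁻¹ ∧
    -- `L^k` for `k ≥ 2`; here `k` is written `k + 2`, and the summation index `i` is written `i + 2`
    (∀ k : ℕ, L (k + 2) = (1 - x 0)⁻¹ *
      ((x 0 + x 0 ^ 2 * t) * hat 0 (L (k + 1))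
        + x 0 ^ 2 * t * (Lj (k + 2) 1 + (t - 1) * D (k + 2) 1)
        + ∑ i : Fin (k + 1), x 0 * x i.succ *
            ((t + 1) * hat 0 (L (k + 1))
              + hat i.succ (Lj (k + 1) (i + 1))
              + (t - 1) * hat i.succ (D (k + 1) (i + 1))
              + hat₁ i (L k)
              + t * (Lj (k + 2) (i + 2) + (t - 1) * D (k + 2) (i + 2))
              + Lj (k + 2) (i + 1)
              + (t - 1) * D (k + 2) (i + 1)))) ∧
    -- `L_k^k = D_k^k` for `k ≥ 1`
    (∀ k : ℕ, 1 ≤ k → Lj k k = D k k) ∧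
    -- `L_j^k` for `1 ≤ j < k`; here `k`, `j`, `i` are written `k + 2`, `j + 1`, `i + 2`
    (∀ (k : ℕ) (j : Fin (k + 1)), Lj (k + 2) (j + 1) = (1 - x 0 * x j.succ)⁻¹ *
      (D (k + 2) (j + 1)
        + ∑ i ∈ Finset.Ioi j, x 0 * x i.succ * Lj (k + 2) (i + 1)
        + ∑ i ∈ Finset.Ici j, x 0 * x i.succ *
            ((t + 1) * hat 0 (L (k + 1))
              + hat i.succ (Lj (k + 1) (i + 1))
              + (t - 1) * hat i.succ (D (k + 1) (i + 1))
              + hat₁ i (L k)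
              + t * (Lj (k + 2) (i + 2) + (t - 1) * D (k + 2) (i + 2))
              + (t - 1) * D (k + 2) (i + 1)))) ∧
    -- `D_1^k` for `k ≥ 1`; here `k` is written `k + 1`
    (∀ k : ℕ, D (k + 1) 1 = x 0 * (1 - x 0 * t)⁻¹ * hat 0 (L k)) ∧
    -- `D_i^k` for `1 < i ≤ k`; here `k`, `i` are written `k + 2`, `i + 2`
    (∀ (k : ℕ) (i : Fin (k + 1)), D (k + 2) (i + 2) = (1 - x 0 * x i.succ * t ^ 2)⁻¹ *
      (D (k + 2) (i + 1)
        + x 0 * x i.succ *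
            (t * D (k + 2) (i + 1)
              + t * hat i.succ (D (k + 1) (i + 1))
              + hat₁ i (L k)
              + (t + 1) * hat 0 (L (k + 1))))) := by
  refine ⟨L_zero, ?_, fun k => ?_, fun k hk => ?_, fun k j => ?_, fun k => ?_, fun k i => ?_⟩
  · have h1 := gen_wAll (k := 1)
    have h2 := gen_wGe_self (k := 0)
    have h3 := gen_wBlock_zero (k := 0)
    have h4 := one_sub_mul_gen_wDec_one (k := 0)
    have h5 : hat (k := 0) 0 (gen wAll) = 1 := by
      rw [← L_eq_gen, L_zero]
      exact map_one _
    rw [zero_add] at h2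
    rw [h5] at h3 h4
    rw [h2] at h1 h3
    rw [h3] at h1
    rw [L_eq_gen, mul_comm]
    refine eq_inv_mul_of_mul_eq (by simp [x, t]) ?_
    linear_combination (1 - x 0 * t) * h1 + x 0 ^ 2 * t ^ 2 * h4
  · have h1 := sum_gen_wBlock (k := k) 0
    have h2 := gen_wAll (k := k + 2)
    have h3 := gen_wBlock_zero (k := k + 1)
    rw [show Finset.Ici (0 : Fin (k + 1)) = Finset.univ from
      Finset.eq_univ_of_forall fun i => Finset.mem_Ici.2 (Fin.zero_le i)] at h1
    refine eq_inv_mul_of_mul_eq (by simp [x]) ?_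
    rw [← Finset.sum_congr rfl fun i _ => gen_wBlock_eq i, h1]
    simp only [L_eq_gen, Lj_eq_gen, D_eq_gen, Fin.val_zero, zero_add]
    linear_combination h2 + h3
  · obtain ⟨k, rfl⟩ := Nat.exists_eq_add_of_le' hk
    rw [Lj_eq_gen, D_eq_gen, gen_wGe_self, add_zero]
  · refine eq_inv_mul_of_mul_eq (by simp [x]) ?_
    have h1 := Finset.add_sum_Ioi_eq_sum_Ici (a := j)
      (f := fun i : Fin (k + 1) => x 0 * x i.succ * Lj (k + 2) (i + 1))
    have h2 := sum_gen_wBlock j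
    -- Separate the terms with `Lj (k + 2) (i + 1)`; the one with `i = j` moves to the left side.
    rw [Finset.sum_congr rfl fun i _ => (gen_wBlock_eq i).trans
      ((congrArg _ (add_right_comm _ _ _)).trans (mul_add _ _ _)), Finset.sum_add_distrib] at h2
    have h3 := Lj_eq_gen (k + 1) (j + 1)
    rw [← D_eq_gen, ← h2] at h3
    linear_combination h3 - h1
  · rw [mul_comm (x 0), mul_assoc, L_eq_gen, D_eq_gen]
    exact eq_inv_mul_of_mul_eq (by simp [x, t]) one_sub_mul_gen_wDec_one
  · have h1 := gen_wDec_succ (k := k + 2) (i + 1)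
    have h2 := gen_wBlockDec i
    refine eq_inv_mul_of_mul_eq (by simp [x, t]) ?_
    simp only [L_eq_gen, D_eq_gen]
    linear_combination h1 + h2
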